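/- Let $M$ be a compact smooth manifold with a smooth Riemannian metric $g$, let $\alpha>1$, and let $\mathrm{Map}(S^2,M)$ be the space of smooth maps $f:S^2\to M$. Define the $\alpha$-energy by $$E_\alpha(f)=\frac12\int_{S^2}(1+|df|^2)^\alpha\,dA-\frac12,$$ where $|df|$ and $dA$ are taken with respect to the round metric of constant curvature and total area one on $S^2$. A map $f$ is a critical point of $E_\alpha$ if $\frac{d}{dt}E_\alpha(f_t)\big|_{t=0}=0$ for every smooth one-parameter family $(f_t)_{t\in\mathbb R}$ in $\mathrm{Map}(S^2,M)$ with $f_0=f$. The group $O(3)$ acts on $\mathrm{Map}(S^2,M)$ by $A\cdot f=f\circ A^{-1}$, and the isotropy group of $f$ is $\{A\in O(3): A\cdot f=f\}$. Let $f\in\mathrm{Map}(S^2,M)$ be a critical point of $E_\alpha$ of finite $\alpha$-energy, i.e. $\int_{S^2}(1+|df|^2)^\alpha\,dA<\infty$. Then either $f$ is constant and its isotropy group is all of $O(3)$, or the isotropy group of $f$ is finite. Moreover, if $f$ is not constant, then for no $v\in S^2$ does the isotropy group of $f$ contain the circle group $\{A\in SO(3): Av=v\}$ of rotations about the axis through $v$.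 -/

import Mathlib

open scoped Manifold ContDiff

noncomputable section

namespace AlphaEnergy

/-- Euclidean three-space. -/
abbrev R3 : Type := EuclideanSpace ℝ (Fin 3)

/-- The two-sphere: the unit sphere of `ℝ³` with its standard smooth structure. -/
abbrev S2 : Type := Metric.sphere (0 : R3) 1

/-- The orthogonal group `O(3)`: all linear isometries of `ℝ³` onto itself. -/
abbrev O3 : Type := R3 ≃ₗᵢ[ℝ] R3

/-- The area measure of the round metric of total area one on the two-sphere: the surface measure
of the unit sphere, divided by its total mass. -/
def area : MeasureTheory.Measure S2 :=
  ((MeasureTheory.volume : MeasureTheory.Measure R3).toSphere Set.univ)⁻¹ •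
    (MeasureTheory.volume : MeasureTheory.Measure R3).toSphere

/-- The differential at `p` of the inclusion of the two-sphere into `ℝ³`. -/
def inclDeriv (p : S2) : TangentSpace (𝓡 2) p →L[ℝ] R3 :=
  mfderiv (𝓡 2) 𝓘(ℝ, R3) ((↑) : S2 → R3) p

/-- The round metric of total area one on the two-sphere: the metric induced from `ℝ³`
(whose total area is `4π`) divided by `4π`. -/
def roundInner (p : S2) (v w : TangentSpace (𝓡 2) p) : ℝ :=
  (4 * Real.pi)⁻¹ * inner ℝ (inclDeriv p v) (inclDeriv p w)

/-- The coordinate basis of the tangent plane at `p`. -/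
def coordVec (p : S2) (i : Fin 2) : TangentSpace (𝓡 2) p :=
  (EuclideanSpace.single i (1 : ℝ) : EuclideanSpace ℝ (Fin 2))

/-- The Gram matrix of the round metric in the coordinate basis at `p`. -/
def gram (p : S2) : Matrix (Fin 2) (Fin 2) ℝ :=
  Matrix.of fun i j => roundInner p (coordVec p i) (coordVec p j)

section Target

variable {n : ℕ} {M : Type*} [TopologicalSpace M] [ChartedSpace (EuclideanSpace ℝ (Fin n)) M]

variable (n M) in
/-- The space of smooth maps from the two-sphere to `M`. -/
abbrev MapS2 : Type _ := ContMDiffMap (𝓡 2) (𝓡 n) S2 M ∞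

variable (n M) in
/-- Smooth Riemannian metrics on `M`. -/
abbrev RiemMetric [IsManifold (𝓡 n) ∞ M] : Type _ :=
  Bundle.ContMDiffRiemannianMetric (𝓡 n) ∞ (EuclideanSpace ℝ (Fin n))
    (fun x : M => TangentSpace (𝓡 n) x)

variable [IsManifold (𝓡 n) ∞ M]

/-- The pullback `f^* g` of a Riemannian metric `g` on `M`, a symmetric bilinear form on the
tangent plane of the two-sphere at `p`. -/
def pullback (g : RiemMetric n M) (f : MapS2 n M) (p : S2) (v w : TangentSpace (𝓡 2) p) : ℝ :=
  g.inner (f p) (mfderiv (𝓡 2) (𝓡 n) f p v) (mfderiv (𝓡 2) (𝓡 n) f p w)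

/-- `|df|²` at `p`: the trace of `f^* g` with respect to the round metric of total area one. -/
def normSqDeriv (g : RiemMetric n M) (f : MapS2 n M) (p : S2) : ℝ :=
  ((gram p)⁻¹ * Matrix.of fun i j => pullback g f p (coordVec p i) (coordVec p j)).trace

/-- The integrand `(1 + |df|²) ^ α` of the `α`-energy. -/
def density (g : RiemMetric n M) (α : ℝ) (f : MapS2 n M) (p : S2) : ℝ :=
  (1 + normSqDeriv g f p) ^ α

/-- `f` has finite `α`-energy. -/
def HasFiniteEnergy (g : RiemMetric n M) (α : ℝ) (f : MapS2 n M) : Prop :=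
  MeasureTheory.Integrable (density g α f) area

/-- The `α`-energy `E_α(f) = 1/2 ∫ (1 + |df|²) ^ α dA - 1/2`. -/
def energy (g : RiemMetric n M) (α : ℝ) (f : MapS2 n M) : ℝ :=
  1 / 2 * ∫ p, density g α f p ∂area - 1 / 2

/-- `f` is a critical point of `E_α`: along every smooth one-parameter family `F t` of smooth maps
with `F 0 = f`, the derivative of `E_α (F t)` at `t = 0` vanishes. -/
def IsCritical (g : RiemMetric n M) (α : ℝ) (f : MapS2 n M) : Prop :=
  ∀ F : ℝ → MapS2 n M,
    ContMDiff (𝓘(ℝ, ℝ).prod (𝓡 2)) (𝓡 n) ∞ (fun q : ℝ × S2 => F q.1 q.2) →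
    F 0 = f → HasDerivAt (fun t => energy g α (F t)) 0 0

end Target

/-- The action of `O(3)` on the two-sphere. -/
def act (A : O3) (p : S2) : S2 := ⟨A p, by simp⟩

theorem contMDiff_act (A : O3) : ContMDiff (𝓡 2) (𝓡 2) ∞ (act A) := by
  have : Fact (Module.finrank ℝ R3 = 2 + 1) := ⟨by simp⟩
  have h : ContMDiff (𝓡 2) 𝓘(ℝ, R3) ∞ (fun p : S2 => A (p : R3)) :=
    A.contDiff.contMDiff.comp contMDiff_coe_sphere
  exact h.codRestrict_sphere (fun p => by simp)

/-- The action of `O(3)` on smooth maps through isometries of the domain,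
`A • f = f ∘ A⁻¹`. -/
instance instMulAction {n : ℕ} {M : Type*} [TopologicalSpace M]
    [ChartedSpace (EuclideanSpace ℝ (Fin n)) M] : MulAction O3 (MapS2 n M) where
  smul A f := ⟨fun p => f (act A⁻¹ p), f.contMDiff.comp (contMDiff_act A⁻¹)⟩
  one_smul f := rfl
  mul_smul A B f := by
    apply ContMDiffMap.ext
    intro p
    change f (act (A * B)⁻¹ p) = f (act B⁻¹ (act A⁻¹ p))
    rw [mul_inv_rev]
    rfl

/-- The isotropy group of `f` under the action of `O(3)`. -/
abbrev isotropy {n : ℕ} {M : Type*} [TopologicalSpace M]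
    [ChartedSpace (EuclideanSpace ℝ (Fin n)) M] (f : MapS2 n M) : Subgroup O3 :=
  MulAction.stabilizer O3 f

/-- The circle group of all rotations of `ℝ³` about the axis through `v`. -/
def rotations (v : S2) : Subgroup O3 where
  carrier := {A | A (v : R3) = v ∧ LinearMap.det (A.toLinearEquiv : R3 →ₗ[ℝ] R3) = 1}
  one_mem' := ⟨rfl, LinearMap.det_id⟩
  mul_mem' := by
    rintro A B ⟨hA, hA'⟩ ⟨hB, hB'⟩
    refine ⟨(congrArg A hB).trans hA, ?_⟩
    have h := LinearMap.det_comp (A.toLinearEquiv : R3 →ₗ[ℝ] R3) (B.toLinearEquiv : R3 →ₗ[ℝ] R3)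
    rw [hA', hB', mul_one] at h
    exact h
  inv_mem' := by
    rintro A ⟨hA, hA'⟩
    refine ⟨?_, ?_⟩
    · exact (congrArg A.symm hA).symm.trans (A.symm_apply_apply _)
    · have h := LinearEquiv.det_symm_mul_det A.toLinearEquiv
      rw [hA', mul_one] at h
      exact h

end AlphaEnergy

end

/-!
A map that is constant on the circles of latitude about an axis is determined by its restriction `u`
to a meridian, and `|df|²` at angle `s` from the pole is `r s = 4π |u'(s)|²`. By Archimedes' theorem
its `α`-energy is `1/4 ∫₀^π (1 + r)^α sin s ds - 1/2` (`IsAxisymmetric.energy_eq`).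

Suppose that such a map is critical. The domain variations `f ∘ bend v P t` stay axisymmetric and
act on meridians by `s ↦ s - arctan (t P(cos s) sin s)`. The first variation formula for all
polynomials `P`, an integration by parts and Weierstrass approximation give the equation
`K' sin = -C cos` on `(0, π)`, where `C = 2α r (1 + r)^(α - 1)` and `K = C - ((1 + r)^α - 1)`.
As `0 ≤ C / 2 ≤ K`, the function `K` decreases on `[0, π/2]` and increases on `[π/2, π]`. Smoothness
at the poles forces `u' = 0` there, because `u` is even about `0` and `π`; so `K` vanishes at both
ends, hence everywhere, and so does `r` (`eq_zero_of_bend_critical`). Thus the map is constant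
(`IsAxisymmetric.const_of_isCritical`).

It remains to produce axial symmetry. If the isotropy group contains all rotations about an axis,
this is immediate. If it is infinite, compactness of `O(3)` gives nontrivial rotations in it that tend
to the identity. Along a subsequence their axes converge, and since their angles tend to zero,
suitable powers of them converge to any given rotation about the limit axis; by continuity the map
is invariant under it (`exists_isAxisymmetric_of_infinite`).
-/

namespace AlphaEnergy

open MeasureTheory Set Filter Topology

/-! ### One-dimensional calculus -/

section

theorem hasDerivAt_intervalIntegral_of_contDiff {Φ : ℝ × ℝ → ℝ} (h : ContDiff ℝ 1 Φ)
    (a b t₀ : ℝ) :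
    HasDerivAt (fun t => ∫ s in a..b, Φ (t, s))
      (∫ s in a..b, fderiv ℝ Φ (t₀, s) (1, 0)) t₀ := by
  have hD : Continuous fun q : ℝ × ℝ => fderiv ℝ Φ q (1, 0) :=
    (h.continuous_fderiv one_ne_zero).clm_apply continuous_const
  obtain ⟨C, hC⟩ := ((isCompact_Icc (a := t₀ - 1) (b := t₀ + 1)).prod
    (isCompact_uIcc (a := a) (b := b))).exists_bound_of_continuousOn hD.continuousOn
  refine (intervalIntegral.hasDerivAt_integral_of_dominated_loc_of_deriv_le (μ := volume)
    (F := fun t s => Φ (t, s)) (F' := fun t s => fderiv ℝ Φ (t, s) (1, 0)) (bound := fun _ => C)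
    (s := Icc (t₀ - 1) (t₀ + 1)) (Icc_mem_nhds (by linarith) (by linarith)) ?_ ?_ ?_ ?_ ?_ ?_).2
  · exact Eventually.of_forall fun t =>
      (h.continuous.comp (by fun_prop : Continuous fun s : ℝ => (t, s))).aestronglyMeasurable
  · exact (h.continuous.comp (by fun_prop : Continuous fun s : ℝ => (t₀, s))).intervalIntegrable _ _
  · exact (hD.comp (by fun_prop : Continuous fun s : ℝ => (t₀, s))).aestronglyMeasurable
  · exact Eventually.of_forall fun s hs t ht => hC (t, s) ⟨ht, uIoc_subset_uIcc hs⟩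
  · exact intervalIntegrable_const
  · refine Eventually.of_forall fun s _ t _ => ?_
    have h1 : HasFDerivAt Φ (fderiv ℝ Φ (t, s)) (t, s) :=
      (h.differentiable one_ne_zero _).hasFDerivAt
    exact h1.comp_hasDerivAt t ((hasDerivAt_id t).prodMk (hasDerivAt_const t s))

theorem contDiff_polynomial_eval (P : Polynomial ℝ) : ContDiff ℝ ∞ fun z : ℝ => P.eval z := by
  simpa using P.contDiff_aeval (𝕜 := ℝ) ∞

/-- A continuous function on `[0, π]` that is orthogonal, for the weight `sin`, to all polynomials
in `cos` vanishes. -/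
theorem eq_zero_of_integral_polynomial_cos_eq_zero {T : ℝ → ℝ} (hT : Continuous T)
    (h : ∀ P : Polynomial ℝ,
      ∫ s in (0 : ℝ)..Real.pi, T s * (P.eval (Real.cos s) * Real.sin s) = 0) :
    ∀ s ∈ Ioo 0 Real.pi, T s = 0 := by
  have hsq : ∫ s in (0 : ℝ)..Real.pi, T s ^ 2 * Real.sin s = 0 := by
    have hI : 0 ≤ ∫ s in (0 : ℝ)..Real.pi, |T s| * Real.sin s :=
      intervalIntegral.integral_nonneg Real.pi_pos.le fun s hs =>
        mul_nonneg (abs_nonneg _) (Real.sin_nonneg_of_mem_Icc hs)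
    refine le_antisymm (le_of_forall_pos_le_add fun ε hε => ?_)
      (intervalIntegral.integral_nonneg Real.pi_pos.le fun s hs =>
        mul_nonneg (sq_nonneg _) (Real.sin_nonneg_of_mem_Icc hs))
    set I := ∫ s in (0 : ℝ)..Real.pi, |T s| * Real.sin s
    -- approximate `T` by a polynomial `P` in `cos`: `∫ T² sin = ∫ T (T - P(cos)) sin` is small
    obtain ⟨P, hP⟩ := exists_polynomial_near_of_continuousOn (-1) 1 (fun z => T (Real.arccos z))
      (hT.comp Real.continuous_arccos).continuousOn (ε / (I + 1)) (by positivity)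
    have hc : Continuous fun s => P.eval (Real.cos s) := P.continuous.comp Real.continuous_cos
    have hs := Real.continuous_sin
    calc ∫ s in (0 : ℝ)..Real.pi, T s ^ 2 * Real.sin s
        = ∫ s in (0 : ℝ)..Real.pi, (T s ^ 2 * Real.sin s
            - T s * (P.eval (Real.cos s) * Real.sin s)) := by
          rw [intervalIntegral.integral_sub, h P, sub_zero] <;>
          exact Continuous.intervalIntegrable (by fun_prop) _ _
      _ ≤ ∫ s in (0 : ℝ)..Real.pi, ε / (I + 1) * (|T s| * Real.sin s) := by
          refine intervalIntegral.integral_mono_on Real.pi_pos.le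
            (Continuous.intervalIntegrable (by fun_prop) _ _)
            (Continuous.intervalIntegrable (by fun_prop) _ _) fun s hs => ?_
          have h1 := hP (Real.cos s) ⟨Real.neg_one_le_cos s, Real.cos_le_one s⟩
          rw [Real.arccos_cos hs.1 hs.2] at h1
          have h2 : T s * (T s - P.eval (Real.cos s)) ≤ |T s| * (ε / (I + 1)) := by
            refine (le_abs_self _).trans ?_
            rw [abs_mul, abs_sub_comm]
            exact mul_le_mul_of_nonneg_left h1.le (abs_nonneg _)
          have := mul_le_mul_of_nonneg_right h2 (Real.sin_nonneg_of_mem_Icc hs)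
          nlinarith
      _ = ε / (I + 1) * I := by rw [intervalIntegral.integral_const_mul]
      _ ≤ 0 + ε := by
          rw [zero_add, div_mul_eq_mul_div, div_le_iff₀ (by positivity)]
          nlinarith
  intro s hs
  by_contra hne
  have hcont : Continuous fun s => T s ^ 2 * Real.sin s :=
    (hT.pow 2).mul Real.continuous_sin
  have hpos : 0 < ∫ s in (0 : ℝ)..Real.pi, T s ^ 2 * Real.sin s := by
    refine intervalIntegral.integral_pos Real.pi_pos hcont.continuousOn
      (fun x hx => mul_nonneg (sq_nonneg _) (Real.sin_nonneg_of_mem_Icc ⟨hx.1.le, hx.2⟩))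
      ⟨s, ⟨hs.1.le, hs.2.le⟩, ?_⟩
    have := Real.sin_pos_of_mem_Ioo hs
    positivity
  exact hpos.ne' hsq

/-- The graph of `y ↦ y ^ α` lies above its tangent line at `1 + x`, evaluated at `y = 1`. -/
theorem rpow_one_add_sub_one_le {α x : ℝ} (hα : 1 ≤ α) (hx : 0 ≤ x) :
    (1 + x) ^ α - 1 ≤ α * x * (1 + x) ^ (α - 1) := by
  have h1 : (0 : ℝ) < 1 + x := by linarith
  have h := one_add_mul_self_le_rpow_one_add (s := (1 + x)⁻¹ - 1)
    (by have := inv_nonneg.2 h1.le; linarith) hα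
  rw [add_sub_cancel, Real.inv_rpow h1.le] at h
  have hp : 0 < (1 + x) ^ α := Real.rpow_pos_of_pos h1 α
  have h2 := mul_le_mul_of_nonneg_left h hp.le
  rw [mul_inv_cancel₀ hp.ne'] at h2
  have h3 : (1 + x) ^ α * (1 + α * ((1 + x)⁻¹ - 1)) = (1 + x) ^ α - α * x * (1 + x) ^ (α - 1) := by
    rw [Real.rpow_sub_one h1.ne']
    field_simp
    ring
  linarith

/-- The derivative at `0` of the energy under the domain variation `s ↦ s - arctan (t κ(s))`; the
squared factor in front of `r` is the square of the derivative of this reparametrization. -/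
theorem hasDerivAt_bend_energy {α : ℝ} {r κ : ℝ → ℝ} (hr : ContDiff ℝ ∞ r)
    (hκ : ContDiff ℝ ∞ κ) (hr0 : ∀ s, 0 ≤ r s) :
    HasDerivAt (fun t : ℝ => ∫ s in (0 : ℝ)..Real.pi,
        (1 + (1 - t * deriv κ s / (1 + (t * κ s) ^ 2)) ^ 2 * r (s - Real.arctan (t * κ s))) ^ α
          * Real.sin s)
      (∫ s in (0 : ℝ)..Real.pi, (-2 * deriv κ s * r s - κ s * deriv r s)
        * α * (1 + r s) ^ (α - 1) * Real.sin s) 0 := by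
  set ρ : ℝ × ℝ → ℝ := fun q => (1 - q.1 * deriv κ q.2 / (1 + (q.1 * κ q.2) ^ 2)) ^ 2
    * r (q.2 - Real.arctan (q.1 * κ q.2)) with hρ
  have hκ' : ContDiff ℝ 1 (deriv κ) :=
    (contDiff_infty_iff_deriv.1 hκ).2.of_le (by exact_mod_cast le_top)
  have hκ1 : ContDiff ℝ 1 κ := hκ.of_le (by exact_mod_cast le_top)
  have hr1 : ContDiff ℝ 1 r := hr.of_le (by exact_mod_cast le_top)
  have hρ0 : ∀ q, 0 ≤ ρ q := fun q => mul_nonneg (sq_nonneg _) (hr0 _)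
  have hρc : ContDiff ℝ 1 ρ := by
    have hden : ∀ q : ℝ × ℝ, 1 + (q.1 * κ q.2) ^ 2 ≠ 0 := fun q => by positivity
    have e1 : ContDiff ℝ 1 fun q : ℝ × ℝ => κ q.2 := hκ1.comp contDiff_snd
    have e2 : ContDiff ℝ 1 fun q : ℝ × ℝ => deriv κ q.2 := hκ'.comp contDiff_snd
    refine ContDiff.mul (ContDiff.pow (contDiff_const.sub
      ((contDiff_fst.mul e2).div (contDiff_const.add ((contDiff_fst.mul e1).pow 2)) hden)) 2) ?_
    exact hr1.comp (contDiff_snd.sub (Real.contDiff_arctan.comp (contDiff_fst.mul e1)))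
  have hΦ : ContDiff ℝ 1 fun q : ℝ × ℝ => (1 + ρ q) ^ α * Real.sin q.2 :=
    ((contDiff_const.add hρc).rpow_const_of_ne fun q => by have := hρ0 q; positivity).mul
      (Real.contDiff_sin.comp contDiff_snd)
  convert hasDerivAt_intervalIntegral_of_contDiff hΦ 0 Real.pi 0 using 1
  refine intervalIntegral.integral_congr fun s _ => ?_
  have h1 : HasDerivAt (fun t : ℝ => (1 + ρ (t, s)) ^ α * Real.sin s)
      (fderiv ℝ (fun q : ℝ × ℝ => (1 + ρ q) ^ α * Real.sin q.2) (0, s) (1, 0)) 0 :=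
    HasFDerivAt.comp_hasDerivAt (f := fun t : ℝ => (t, s)) 0
      (hΦ.differentiable one_ne_zero (0, s)).hasFDerivAt
      ((hasDerivAt_id (0 : ℝ)).prodMk (hasDerivAt_const _ s))
  refine HasDerivAt.unique ?_ h1
  have ht : HasDerivAt (fun t : ℝ => t * κ s) (κ s) 0 := by
    simpa using (hasDerivAt_id (0 : ℝ)).mul_const (κ s)
  have ht' : HasDerivAt (fun t : ℝ => t * deriv κ s) (deriv κ s) 0 := by
    simpa using (hasDerivAt_id (0 : ℝ)).mul_const (deriv κ s)
  have ha : HasDerivAt (fun t : ℝ => s - Real.arctan (t * κ s)) (-κ s) 0 := by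
    have := (ht.arctan).const_sub s
    simpa using this
  have hq : HasDerivAt (fun t : ℝ => 1 - t * deriv κ s / (1 + (t * κ s) ^ 2)) (-deriv κ s) 0 := by
    have := (ht'.div ((ht.pow 2).const_add 1)
      (by simp : 1 + (0 * κ s) ^ 2 ≠ 0)).const_sub 1
    simpa using this
  have hrr : HasDerivAt (fun t : ℝ => r (s - Real.arctan (t * κ s))) (deriv r s * (-κ s)) 0 := by
    have h2 : HasDerivAt r (deriv r s) (s - Real.arctan (0 * κ s)) := by
      simpa using (hr1.differentiable one_ne_zero s).hasDerivAt
    exact h2.comp 0 ha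
  have hρt : HasDerivAt (fun t : ℝ => 1 + ρ (t, s)) (-2 * deriv κ s * r s - κ s * deriv r s) 0 := by
    have := ((hq.pow 2).mul hrr).const_add 1
    refine this.congr_deriv ?_
    simp
    ring
  have h0 : ρ (0, s) = r s := by simp [hρ]
  have := (hρt.rpow_const (p := α)
    (Or.inl (by have := hρ0 (0, s); positivity))).mul_const (Real.sin s)
  rw [h0] at this
  exact this


/-- The one-dimensional rigidity statement. With `C = 2α r (1 + r)^(α - 1)` and
`K = C - ((1 + r)^α - 1)`, testing with all fields `κ = P(cos) sin` yields the equation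
`K' sin = -C cos`, so the nonnegative function `K` is antitone on `[0, π/2]`, monotone on
`[π/2, π]` and zero at both ends. -/
theorem eq_zero_of_bend_critical {α : ℝ} (hα : 1 < α) {r : ℝ → ℝ} (hr : ContDiff ℝ ∞ r)
    (hr0 : ∀ s, 0 ≤ r s) (h0 : r 0 = 0) (hπ : r Real.pi = 0)
    (h : ∀ P : Polynomial ℝ, ∀ κ : ℝ → ℝ, (κ = fun s => P.eval (Real.cos s) * Real.sin s) →
      ∫ s in (0 : ℝ)..Real.pi, (-2 * deriv κ s * r s - κ s * deriv r s)
        * α * (1 + r s) ^ (α - 1) * Real.sin s = 0) :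
    ∀ s ∈ Icc 0 Real.pi, r s = 0 := by
  have hpos : ∀ s, 0 < 1 + r s := fun s => by have := hr0 s; positivity
  set C : ℝ → ℝ := fun s => 2 * α * r s * (1 + r s) ^ (α - 1) with hC
  set B : ℝ → ℝ := fun s => (1 + r s) ^ α - 1 with hB
  set K : ℝ → ℝ := fun s => C s - B s with hK
  have hCs : ContDiff ℝ ∞ C :=
    (contDiff_const.mul hr).mul ((contDiff_const.add hr).rpow_const_of_ne fun s => (hpos s).ne')
  have hBs : ContDiff ℝ ∞ B :=
    ((contDiff_const.add hr).rpow_const_of_ne fun s => (hpos s).ne').sub contDiff_const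
  have hKs : ContDiff ℝ ∞ K := hCs.sub hBs
  have hone : (1 : WithTop ℕ∞) ≤ ∞ := by exact_mod_cast le_top
  have hdr : Continuous (deriv r) := hr.continuous_deriv hone
  have hdC : Continuous (deriv C) := hCs.continuous_deriv hone
  have hdB : Continuous (deriv B) := hBs.continuous_deriv hone
  have hdK : Continuous (deriv K) := hKs.continuous_deriv hone
  have hne : (∞ : WithTop ℕ∞) ≠ 0 := by simp
  have hCd := hCs.differentiable hne
  have hBd := hBs.differentiable hne
  have hKd := hKs.differentiable hne
  have hrd := hr.differentiable hne
  have hB' : ∀ s, deriv B s = deriv r s * α * (1 + r s) ^ (α - 1) := fun s =>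
    ((((hrd s).hasDerivAt.const_add 1).rpow_const (p := α) (Or.inl (hpos s).ne')).sub_const 1).deriv
  have hK' : ∀ s, deriv K s = deriv C s - deriv B s := fun s => deriv_sub (hCd s) (hBd s)
  have hC0 : ∀ s, 0 ≤ C s := fun s => by
    have := hr0 s; have := hpos s; positivity
  have hKC : ∀ s, C s / 2 ≤ K s := fun s => by
    have := rpow_one_add_sub_one_le hα.le (hr0 s)
    simp only [hK, hC, hB]
    linarith
  -- the equation satisfied by `K`, from integration by parts and density of polynomials
  have hT : ∀ s ∈ Ioo 0 Real.pi, deriv K s * Real.sin s + C s * Real.cos s = 0 := by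
    refine eq_zero_of_integral_polynomial_cos_eq_zero
      (T := fun s => deriv K s * Real.sin s + C s * Real.cos s)
      ((hdK.mul Real.continuous_sin).add (hCs.continuous.mul Real.continuous_cos)) fun P => ?_
    set κ : ℝ → ℝ := fun s => P.eval (Real.cos s) * Real.sin s with hκdef
    have hκ : ContDiff ℝ ∞ κ :=
      ((contDiff_polynomial_eval P).comp Real.contDiff_cos).mul Real.contDiff_sin
    have hκd := hκ.differentiable hne
    have hdκ : Continuous (deriv κ) := hκ.continuous_deriv hone
    have hparts : ∫ s in (0 : ℝ)..Real.pi, ((deriv C s * Real.sin s + C s * Real.cos s) * κ s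
        + C s * Real.sin s * deriv κ s) = 0 := by
      rw [intervalIntegral.integral_eq_sub_of_hasDerivAt
        (f := fun s => C s * Real.sin s * κ s) (f' := fun s => (deriv C s * Real.sin s
          + C s * Real.cos s) * κ s + C s * Real.sin s * deriv κ s)
        (fun s _ => ((hCd s).hasDerivAt.mul (Real.hasDerivAt_sin s)).mul (hκd s).hasDerivAt)]
      · simp
      · have := hCs.continuous
        have := hκ.continuous
        exact Continuous.intervalIntegrable (by fun_prop) _ _
    have hP := h P κ rfl
    refine Eq.trans ?_ ((congrArg₂ (· + ·) hparts hP).trans (add_zero 0))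
    have c1 := hCs.continuous
    have c2 := hκ.continuous
    have c3 := hr.continuous
    have c4 : Continuous fun s => (1 + r s) ^ (α - 1) :=
      (continuous_const.add c3).rpow_const fun s => Or.inl (hpos s).ne'
    rw [← intervalIntegral.integral_add]
    · refine intervalIntegral.integral_congr fun s _ => ?_
      simp only [hK', hB', hκdef, hC]
      ring
    · exact Continuous.intervalIntegrable (by fun_prop) _ _
    · exact Continuous.intervalIntegrable (by fun_prop) _ _
  have hK0 : K 0 = 0 := by simp [hK, hC, hB, h0]
  have hKπ : K Real.pi = 0 := by simp [hK, hC, hB, hπ]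
  have hpi := Real.pi_pos
  have hanti : AntitoneOn K (Icc 0 (Real.pi / 2)) := by
    refine antitoneOn_of_deriv_nonpos (convex_Icc _ _) hKs.continuous.continuousOn
      hKd.differentiableOn fun s hs => ?_
    rw [interior_Icc] at hs
    have hsin := Real.sin_pos_of_mem_Ioo (x := s) ⟨hs.1, by linarith [hs.2]⟩
    have hcos := Real.cos_nonneg_of_mem_Icc (x := s) ⟨by linarith [hs.1], hs.2.le⟩
    have := hT s ⟨hs.1, by linarith [hs.2]⟩
    have h2 := mul_nonneg (hC0 s) hcos
    by_contra hcon
    have := mul_pos (not_le.1 hcon) hsin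
    linarith
  have hmono : MonotoneOn K (Icc (Real.pi / 2) Real.pi) := by
    refine monotoneOn_of_deriv_nonneg (convex_Icc _ _) hKs.continuous.continuousOn
      hKd.differentiableOn fun s hs => ?_
    rw [interior_Icc] at hs
    have hsin := Real.sin_pos_of_mem_Ioo (x := s) ⟨by linarith [hs.1], hs.2⟩
    have hcos := Real.cos_nonpos_of_pi_div_two_le_of_le hs.1.le (by linarith [hs.2])
    have := hT s ⟨by linarith [hs.1], hs.2⟩
    have h2 := mul_nonpos_of_nonneg_of_nonpos (hC0 s) hcos
    by_contra hcon
    have := mul_neg_of_neg_of_pos (not_le.1 hcon) hsin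
    linarith
  intro s hs
  have hKs0 : K s ≤ 0 := by
    rcases le_total s (Real.pi / 2) with hle | hle
    · rw [← hK0]
      exact hanti ⟨le_rfl, by linarith⟩ ⟨hs.1, hle⟩ hs.1
    · rw [← hKπ]
      exact hmono ⟨hle, hs.2⟩ ⟨by linarith, le_rfl⟩ hs.2
  have hCle : C s ≤ 0 := by linarith [hKC s]
  have hrp := Real.rpow_pos_of_pos (hpos s) (α - 1)
  by_contra hrs
  have hrpos : 0 < r s := lt_of_le_of_ne (hr0 s) (Ne.symm hrs)
  have : 0 < C s := by simp only [hC]; positivity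
  linarith

end

/-! ### Spherical coordinates and Archimedes' theorem -/

section

open scoped ENNReal Pointwise

theorem lintegral_even {h : ℝ → ℝ≥0∞} (hh : ∀ x, h (-x) = h x) :
    ∫⁻ x, h x = 2 * ∫⁻ x in Ioi 0, h x := by
  have h1 : ∫⁻ x in Iio (0 : ℝ), h x = ∫⁻ x in Ioi (0 : ℝ), h x := by
    have := (Measure.measurePreserving_neg (volume : Measure ℝ)).setLIntegral_comp_preimage_emb
      (MeasurableEquiv.neg ℝ).measurableEmbedding h (Iio 0)
    rw [← this]
    have he : Neg.neg ⁻¹' Iio (0 : ℝ) = Ioi 0 := by ext x; simp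
    rw [he]
    simp [hh]
  rw [← setLIntegral_univ, ← Iio_union_Ici (a := (0 : ℝ)),
    lintegral_union measurableSet_Ici (by
      rw [Set.disjoint_left]; exact fun x hx hx' => not_le.2 (mem_Iio.1 hx) (mem_Ici.1 hx')),
    setLIntegral_congr Ioi_ae_eq_Ici.symm, h1, two_mul]

/-- Polar coordinates for a function of `x² + y²` on the plane, unfolded to a line. -/
theorem lintegral_radial_plane {h : ℝ → ℝ≥0∞} (hh : Measurable h) :
    ∫⁻ q : ℝ × ℝ, h (q.1 ^ 2 + q.2 ^ 2)
      = ENNReal.ofReal Real.pi * ∫⁻ r : ℝ, ENNReal.ofReal |r| * h (r ^ 2) := by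
  rw [← lintegral_comp_polarCoord_symm, lintegral_even (by simp)]
  have e : ∀ p ∈ polarCoord.target, ENNReal.ofReal p.1 • h ((polarCoord.symm p).1 ^ 2
      + (polarCoord.symm p).2 ^ 2) = ENNReal.ofReal p.1 * h (p.1 ^ 2) := by
    intro p _
    rw [polarCoord_symm_apply, smul_eq_mul]
    congr 2
    have := Real.cos_sq_add_sin_sq p.2
    linear_combination p.1 ^ 2 * this
  rw [setLIntegral_congr_fun polarCoord.open_target.measurableSet e, polarCoord_target,
    Measure.volume_eq_prod, ← Measure.prod_restrict,
    lintegral_prod _ (by fun_prop)]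
  simp only [lintegral_const, Measure.restrict_apply MeasurableSet.univ, univ_inter,
    Real.volume_Ioo]
  rw [lintegral_mul_const _ (by fun_prop), mul_left_comm, mul_comm, ← mul_assoc]
  have e2 : ENNReal.ofReal (Real.pi - -Real.pi) = ENNReal.ofReal Real.pi * 2 := by
    rw [← ENNReal.ofReal_ofNat 2, ← ENNReal.ofReal_mul Real.pi_pos.le]
    congr 1; ring
  rw [e2, mul_assoc, mul_assoc]
  rw [mul_left_comm 2]
  congr 2
  refine setLIntegral_congr_fun measurableSet_Ioi fun r hr => ?_
  simp only [abs_of_pos (mem_Ioi.1 hr)]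

theorem exists_orthonormalBasis_zero_eq (v : S2) :
    ∃ b : OrthonormalBasis (Fin 3) ℝ R3, b 0 = v := by
  obtain ⟨b, hb⟩ := Orthonormal.exists_orthonormalBasis_extension_of_card_eq
    (ι := Fin 3) (𝕜 := ℝ) (E := R3) (by simp) (v := fun _ => (v : R3)) (s := {0}) (by
      constructor
      · intro i; exact norm_eq_of_mem_sphere v
      · intro i j hij; exact absurd (Subsingleton.elim i j) hij)
  exact ⟨b, hb 0 rfl⟩

/-- Spherical coordinates for functions of the height along a unit vector and of the norm. -/
theorem lintegral_height_norm (v : S2) {H : ℝ × ℝ → ℝ≥0∞} (hH : Measurable H) :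
    ∫⁻ x : R3, H (inner ℝ (v : R3) x, ‖x‖) = ENNReal.ofReal Real.pi *
      ∫⁻ p in Ioi (0 : ℝ) ×ˢ Ioo (-Real.pi) Real.pi,
        ENNReal.ofReal (p.1 ^ 2) *
          (ENNReal.ofReal |Real.sin p.2| * H (p.1 * Real.cos p.2, p.1)) := by
  obtain ⟨b, hb⟩ := exists_orthonormalBasis_zero_eq v
  -- cylindrical coordinates about `v`, then polar coordinates for height and distance to the axis
  have h1 : ∫⁻ x : R3, H (inner ℝ (v : R3) x, ‖x‖)
      = ∫⁻ y : EuclideanSpace ℝ (Fin 3), H (y 0, ‖y‖) := by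
    rw [← b.measurePreserving_repr.lintegral_comp_emb b.repr.toHomeomorph.measurableEmbedding
      (fun y => H (y 0, ‖y‖))]
    refine lintegral_congr fun x => ?_
    rw [b.repr_apply_apply, hb, LinearIsometryEquiv.norm_map]
  have h2 : ∫⁻ y : EuclideanSpace ℝ (Fin 3), H (y 0, ‖y‖)
      = ∫⁻ w : Fin 3 → ℝ, H (w 0, √(w 0 ^ 2 + (w 1 ^ 2 + w 2 ^ 2))) := by
    rw [← (PiLp.volume_preserving_ofLp (Fin 3)).lintegral_comp_emb
      (MeasurableEquiv.toLp 2 (Fin 3 → ℝ)).symm.measurableEmbedding]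
    refine lintegral_congr fun x => ?_
    rw [EuclideanSpace.norm_eq, Fin.sum_univ_three]
    simp [add_assoc]
  have h3 : ∫⁻ w : Fin 3 → ℝ, H (w 0, √(w 0 ^ 2 + (w 1 ^ 2 + w 2 ^ 2)))
      = ∫⁻ z : ℝ, ∫⁻ q : ℝ × ℝ, H (z, √(z ^ 2 + (q.1 ^ 2 + q.2 ^ 2))) := by
    rw [← (volume_preserving_piFinSuccAbove (fun _ : Fin 3 => ℝ) 0).symm.lintegral_comp_emb
      (MeasurableEquiv.piFinSuccAbove (fun _ : Fin 3 => ℝ) 0).symm.measurableEmbedding,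
      Measure.volume_eq_prod, lintegral_prod _ (by
        refine Measurable.aemeasurable ?_
        fun_prop)]
    refine lintegral_congr fun z => ?_
    rw [← (volume_preserving_finTwoArrow ℝ).lintegral_comp_emb
      (MeasurableEquiv.finTwoArrow (α := ℝ)).measurableEmbedding]
    rfl
  rw [h1, h2, h3]
  have h4 : ∀ z : ℝ, ∫⁻ q : ℝ × ℝ, H (z, √(z ^ 2 + (q.1 ^ 2 + q.2 ^ 2))) =
      ENNReal.ofReal Real.pi * ∫⁻ r : ℝ, ENNReal.ofReal |r| * H (z, √(z ^ 2 + r ^ 2)) := fun z =>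
    lintegral_radial_plane (h := fun w => H (z, √(z ^ 2 + w))) (by fun_prop)
  have hm : Measurable fun q : ℝ × ℝ => ENNReal.ofReal |q.2| * H (q.1, √(q.1 ^ 2 + q.2 ^ 2)) := by
    fun_prop
  simp_rw [h4]
  rw [lintegral_const_mul' _ _ ENNReal.ofReal_ne_top,
    ← lintegral_prod (fun q : ℝ × ℝ => ENNReal.ofReal |q.2| * H (q.1, √(q.1 ^ 2 + q.2 ^ 2)))
      hm.aemeasurable, ← Measure.volume_eq_prod, ← lintegral_comp_polarCoord_symm]
  congr 1
  refine setLIntegral_congr_fun polarCoord.open_target.measurableSet fun p hp => ?_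
  have hp1 : 0 < p.1 := hp.1
  have hs : p.1 ^ 2 = (p.1 * Real.cos p.2) ^ 2 + (p.1 * Real.sin p.2) ^ 2 := by
    have := Real.cos_sq_add_sin_sq p.2
    linear_combination -p.1 ^ 2 * this
  simp only [polarCoord_symm_apply, smul_eq_mul]
  rw [← hs, Real.sqrt_sq hp1.le, abs_mul, abs_of_pos hp1, ENNReal.ofReal_mul hp1.le, pow_two,
    ENNReal.ofReal_mul hp1.le]
  ring

theorem lintegral_abs_sin_arccos_cos {h : ℝ → ℝ≥0∞} :
    ∫⁻ φ in Ioo (-Real.pi) Real.pi, ENNReal.ofReal |Real.sin φ| * h (Real.arccos (Real.cos φ))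
      = 2 * ∫⁻ φ in Ioo 0 Real.pi, ENNReal.ofReal (Real.sin φ) * h φ := by
  rw [← lintegral_indicator measurableSet_Ioo, lintegral_even (by
    intro x
    have : -x ∈ Ioo (-Real.pi) Real.pi ↔ x ∈ Ioo (-Real.pi) Real.pi := by
      simp only [mem_Ioo]; constructor <;> rintro ⟨h1, h2⟩ <;> constructor <;> linarith
    simp only [indicator, this, Real.sin_neg, abs_neg, Real.cos_neg])]
  congr 1
  rw [← lintegral_indicator measurableSet_Ioi, ← lintegral_indicator measurableSet_Ioo]
  refine lintegral_congr fun x => ?_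
  have hpi := Real.pi_pos
  by_cases h1 : x ∈ Ioo 0 Real.pi
  · have h2 : x ∈ Ioo (-Real.pi) Real.pi := ⟨by linarith [h1.1], h1.2⟩
    rw [indicator_of_mem h1, indicator_of_mem (mem_Ioi.2 h1.1), indicator_of_mem h2,
      Real.arccos_cos h1.1.le h1.2.le, abs_of_pos (Real.sin_pos_of_mem_Ioo h1)]
  · rw [indicator_of_notMem h1]
    by_cases h2 : 0 < x
    · rw [indicator_of_mem (mem_Ioi.2 h2), indicator_of_notMem fun h3 => h1 ⟨h2, h3.2⟩]
    · rw [indicator_of_notMem (by simpa using h2)]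

/-- The angle between the unit vectors `v` and `p`. -/
noncomputable def angleTo (v p : S2) : ℝ := Real.arccos (inner ℝ (v : R3) (p : R3))

theorem continuous_angleTo (v : S2) : Continuous (angleTo v) :=
  Real.continuous_arccos.comp (by fun_prop)

/-- The distribution of the angle to the axis, up to a constant `W` whose value `2π` is recovered
from the total mass. -/
theorem toSphere_preimage_angleTo (v : S2) : ∃ W : ℝ≥0∞, ∀ A : Set ℝ, MeasurableSet A →
    (volume : Measure R3).toSphere (angleTo v ⁻¹' A)
      = W * ∫⁻ φ in Ioo 0 Real.pi ∩ A, ENNReal.ofReal (Real.sin φ) := by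
  refine ⟨3 * (ENNReal.ofReal Real.pi * ((∫⁻ R in Ioi (0 : ℝ),
    ENNReal.ofReal (R ^ 2) * (Ioo (0 : ℝ) 1).indicator 1 R) * 2)), fun A hA => ?_⟩
  rw [Measure.toSphere_apply' _ (hA.preimage (continuous_angleTo v).measurable)]
  set Q : Set (ℝ × ℝ) := {q | q.2 ∈ Ioo (0 : ℝ) 1 ∧ Real.arccos (q.1 / q.2) ∈ A} with hQ
  have hQm : MeasurableSet Q :=
    (measurableSet_Ioo.preimage measurable_snd).inter (hA.preimage (by fun_prop))
  -- the solid cone over the preimage that defines `toSphere`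
  have hset : Ioo (0 : ℝ) 1 • ((↑) '' (angleTo v ⁻¹' A) : Set R3)
      = (fun x : R3 => (inner ℝ (v : R3) x, ‖x‖)) ⁻¹' Q := by
    ext x
    simp only [Set.mem_smul, mem_image, mem_preimage, hQ, mem_ofPred_eq]
    constructor
    · rintro ⟨c, hc, _, ⟨p, hp, rfl⟩, rfl⟩
      have hp1 : ‖(p : R3)‖ = 1 := norm_eq_of_mem_sphere p
      rw [norm_smul, hp1, mul_one, Real.norm_of_nonneg hc.1.le, inner_smul_right,
        mul_div_cancel_left₀ _ hc.1.ne']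
      exact ⟨hc, hp⟩
    · rintro ⟨hx, hxA⟩
      have hx0 : x ≠ 0 := norm_pos_iff.1 hx.1
      refine ⟨‖x‖, hx, ‖x‖⁻¹ • x, ⟨⟨‖x‖⁻¹ • x, ?_⟩, ?_, rfl⟩, ?_⟩
      · simp [norm_smul, hx0]
      · change Real.arccos (inner ℝ (v : R3) (‖x‖⁻¹ • x)) ∈ A
        rw [inner_smul_right, mul_comm, ← div_eq_mul_inv]
        exact hxA
      · rw [smul_smul, mul_inv_cancel₀ hx.1.ne', one_smul]
  have hmeas : Measurable fun x : R3 => (inner ℝ (v : R3) x, ‖x‖) := by fun_prop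
  rw [hset, ← lintegral_indicator_one (hmeas hQm)]
  have hcomp : ∀ x : R3, ((fun x : R3 => (inner ℝ (v : R3) x, ‖x‖)) ⁻¹' Q).indicator
      (1 : R3 → ℝ≥0∞) x = Q.indicator 1 (inner ℝ (v : R3) x, ‖x‖) := fun x => rfl
  simp_rw [hcomp]
  rw [lintegral_height_norm v (measurable_one.indicator hQm)]
  have hint : ∀ p ∈ Ioi (0 : ℝ) ×ˢ Ioo (-Real.pi) Real.pi,
      ENNReal.ofReal (p.1 ^ 2) * (ENNReal.ofReal |Real.sin p.2|
        * Q.indicator 1 (p.1 * Real.cos p.2, p.1))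
      = (ENNReal.ofReal (p.1 ^ 2) * (Ioo (0 : ℝ) 1).indicator 1 p.1)
        * (ENNReal.ofReal |Real.sin p.2| * A.indicator 1 (Real.arccos (Real.cos p.2))) := by
    intro p hp
    have hp1 : p.1 ≠ 0 := (mem_Ioi.1 hp.1).ne'
    have : Q.indicator (1 : ℝ × ℝ → ℝ≥0∞) (p.1 * Real.cos p.2, p.1)
        = (Ioo (0 : ℝ) 1).indicator 1 p.1 * A.indicator 1 (Real.arccos (Real.cos p.2)) := by
      by_cases h1 : p.1 ∈ Ioo (0 : ℝ) 1 <;> by_cases h2 : Real.arccos (Real.cos p.2) ∈ A <;>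
        simp [indicator, hQ, h1, h2, mul_div_cancel_left₀ _ hp1, -mem_Ioo]
    rw [this]
    ring
  rw [setLIntegral_congr_fun (measurableSet_Ioi.prod measurableSet_Ioo) hint,
    Measure.volume_eq_prod, ← Measure.prod_restrict,
    lintegral_prod_mul
      (f := fun R : ℝ => ENNReal.ofReal (R ^ 2) * (Ioo (0 : ℝ) 1).indicator 1 R)
      (g := fun φ => ENNReal.ofReal |Real.sin φ| * A.indicator 1 (Real.arccos (Real.cos φ)))
      (Measurable.aemeasurable
        (by fun_prop (disch := exact measurableSet_Ioo)))
      (Measurable.aemeasurable (by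
        have := (measurable_one (α := ℝ≥0∞) (β := ℝ)).indicator hA
        fun_prop)),
    lintegral_abs_sin_arccos_cos]
  have hlast : ∫⁻ φ in Ioo 0 Real.pi, ENNReal.ofReal (Real.sin φ) * A.indicator 1 φ
      = ∫⁻ φ in Ioo 0 Real.pi ∩ A, ENNReal.ofReal (Real.sin φ) := by
    rw [inter_comm, ← setLIntegral_indicator hA]
    refine lintegral_congr fun φ => ?_
    by_cases h : φ ∈ A <;> simp [h]
  rw [hlast]
  simp only [finrank_euclideanSpace, Fintype.card_fin, Nat.cast_ofNat]
  ring

theorem lintegral_sin : ∫⁻ φ in Ioo 0 Real.pi, ENNReal.ofReal (Real.sin φ) = 2 := by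
  rw [setLIntegral_congr Ioo_ae_eq_Ioc, ← ofReal_integral_eq_lintegral_ofReal
    (Real.continuous_sin.intervalIntegrable 0 Real.pi).1, ← intervalIntegral.integral_of_le
      Real.pi_pos.le, integral_sin]
  · norm_num
  · filter_upwards [ae_restrict_mem measurableSet_Ioc] with s hs
    exact Real.sin_nonneg_of_mem_Icc ⟨hs.1.le, hs.2⟩

/-- Archimedes: the angle to a fixed axis has density `sin s / 2` on `(0, π)`. -/
theorem map_angleTo_area (v : S2) : Measure.map (angleTo v) area =
    (volume.restrict (Ioo 0 Real.pi)).withDensity fun s => ENNReal.ofReal (Real.sin s / 2) := by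
  obtain ⟨W, hW⟩ := toSphere_preimage_angleTo v
  have huniv := hW univ MeasurableSet.univ
  rw [preimage_univ, inter_univ, lintegral_sin] at huniv
  have hW0 : W ≠ 0 := fun h => Measure.toSphere_ne_zero (volume : Measure R3) (by
    rw [← Measure.measure_univ_eq_zero, huniv, h, zero_mul])
  have hWt : W ≠ ⊤ := fun h => measure_ne_top ((volume : Measure R3).toSphere) univ (by
    rw [huniv, h, ENNReal.top_mul two_ne_zero])
  ext A hA
  rw [Measure.map_apply (continuous_angleTo v).measurable hA, withDensity_apply _ hA,
    Measure.restrict_restrict hA, area, Measure.smul_apply, hW A hA, huniv, smul_eq_mul]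
  have : ∀ s : ℝ, ENNReal.ofReal (Real.sin s / 2) = 2⁻¹ * ENNReal.ofReal (Real.sin s) := fun s => by
    rw [div_eq_inv_mul, ENNReal.ofReal_mul (by norm_num), ENNReal.ofReal_inv_of_pos (by norm_num)]
    norm_num
  simp_rw [this]
  rw [lintegral_const_mul' _ _ (by simp), inter_comm A,
    ENNReal.mul_inv (Or.inl hW0) (Or.inl hWt), mul_comm W⁻¹, mul_assoc, ← mul_assoc W⁻¹,
    ENNReal.inv_mul_cancel hW0 hWt, one_mul]

theorem integral_comp_angleTo (v : S2) {G : ℝ → ℝ} (hG : Continuous G) :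
    ∫ p, G (angleTo v p) ∂area = 1 / 2 * ∫ s in (0 : ℝ)..Real.pi, G s * Real.sin s := by
  rw [← integral_map (continuous_angleTo v).aemeasurable hG.aestronglyMeasurable, map_angleTo_area,
    integral_withDensity_eq_integral_toReal_smul (by fun_prop) (by simp),
    ← integral_Ioc_eq_integral_Ioo, ← intervalIntegral.integral_of_le Real.pi_pos.le,
    ← intervalIntegral.integral_const_mul]
  refine intervalIntegral.integral_congr fun s hs => ?_
  rw [uIcc_of_le Real.pi_pos.le] at hs
  have := Real.sin_nonneg_of_mem_Icc hs
  simp only [smul_eq_mul]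
  rw [ENNReal.toReal_ofReal (by positivity)]
  ring

end

/-! ### The squared speed of curves -/

section

variable {n : ℕ} {M : Type*} [TopologicalSpace M] [ChartedSpace (EuclideanSpace ℝ (Fin n)) M]
  [IsManifold (𝓡 n) ∞ M]

/-- The squared speed of a curve in `M`. -/
noncomputable def speedSq (g : RiemMetric n M) (u : ℝ → M) (s : ℝ) : ℝ :=
  g.inner (u s) (mfderiv 𝓘(ℝ, ℝ) (𝓡 n) u s (1 : ℝ)) (mfderiv 𝓘(ℝ, ℝ) (𝓡 n) u s (1 : ℝ))

theorem inner_self_nonneg (g : RiemMetric n M) (x : M) (w : TangentSpace (𝓡 n) x) :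
    0 ≤ g.inner x w w := by
  by_cases hw : w = 0
  · simp [hw]
  · exact (g.pos x w hw).le

theorem speedSq_nonneg (g : RiemMetric n M) (u : ℝ → M) (s : ℝ) : 0 ≤ speedSq g u s :=
  inner_self_nonneg g _ _

theorem contDiff_speedSq (g : RiemMetric n M) {u : ℝ → M} (hu : ContMDiff 𝓘(ℝ, ℝ) (𝓡 n) ∞ u) :
    ContDiff ℝ ∞ (speedSq g u) := by
  have hone : ContMDiff 𝓘(ℝ, ℝ) (𝓘(ℝ, ℝ).prod 𝓘(ℝ, ℝ)) ∞
      (fun s : ℝ => (⟨s, (1 : ℝ)⟩ : TangentBundle 𝓘(ℝ, ℝ) ℝ)) := fun s =>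
    contMDiffAt_vectorSpace_iff_contDiffAt.2 contDiffAt_const
  have hv : ContMDiff 𝓘(ℝ, ℝ) ((𝓡 n).prod 𝓘(ℝ, EuclideanSpace ℝ (Fin n))) ∞
      (fun s : ℝ => Bundle.TotalSpace.mk' (EuclideanSpace ℝ (Fin n))
        (E := fun x : M => TangentSpace (𝓡 n) x) (u s)
        (mfderiv 𝓘(ℝ, ℝ) (𝓡 n) u s (1 : ℝ))) :=
    (hu.contMDiff_tangentMap (m := ∞) (by simp)).comp hone
  have hg := g.contMDiff.comp hu
  have := ContMDiff.clm_bundle_apply₂ (F₃ := ℝ) (E₃ := fun _ : M => ℝ) hg hv hv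
  rw [← contMDiff_iff_contDiff]
  intro s
  exact (Bundle.contMDiffAt_totalSpace.1 (this s)).2

theorem speedSq_comp (g : RiemMetric n M) {u : ℝ → M} (hu : ContMDiff 𝓘(ℝ, ℝ) (𝓡 n) ∞ u)
    {ψ : ℝ → ℝ} {ψ' s : ℝ} (hψ : HasDerivAt ψ ψ' s) :
    speedSq g (u ∘ ψ) s = ψ' ^ 2 * speedSq g u (ψ s) := by
  have h1 : HasMFDerivAt 𝓘(ℝ, ℝ) (𝓡 n) (u ∘ ψ) s
      ((mfderiv 𝓘(ℝ, ℝ) (𝓡 n) u (ψ s)).comp (ContinuousLinearMap.toSpanSingleton ℝ ψ')) :=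
    (hu.mdifferentiableAt (by simp)).hasMFDerivAt.comp s hψ.hasFDerivAt.hasMFDerivAt
  have h2 : mfderiv 𝓘(ℝ, ℝ) (𝓡 n) (u ∘ ψ) s (1 : ℝ)
      = ψ' • mfderiv 𝓘(ℝ, ℝ) (𝓡 n) u (ψ s) (1 : ℝ) := by
    rw [h1.mfderiv]
    have : (ContinuousLinearMap.toSpanSingleton ℝ ψ') (1 : ℝ) = ψ' • (1 : ℝ) := by simp
    refine (congrArg (mfderiv 𝓘(ℝ, ℝ) (𝓡 n) u (ψ s)) this).trans ?_
    exact map_smul _ _ _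
  unfold speedSq
  rw [h2]
  simp only [Function.comp_apply, map_smul, smul_apply, smul_eq_mul]
  ring

/-- A curve that is symmetric about a parameter value is stationary there. -/
theorem speedSq_eq_zero_of_reflection (g : RiemMetric n M) {u : ℝ → M}
    (hu : ContMDiff 𝓘(ℝ, ℝ) (𝓡 n) ∞ u) {c : ℝ} (h : ∀ s, u (2 * c - s) = u s) :
    speedSq g u c = 0 := by
  have hd : HasMFDerivAt 𝓘(ℝ, ℝ) (𝓡 n) u c (mfderiv 𝓘(ℝ, ℝ) (𝓡 n) u c) :=
    (hu.mdifferentiableAt (by simp)).hasMFDerivAt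
  have hr : HasDerivAt (fun s : ℝ => 2 * c - s) (-1) c := by
    simpa using (hasDerivAt_id c).const_sub (2 * c)
  have hd' : HasMFDerivAt 𝓘(ℝ, ℝ) (𝓡 n) u (2 * c - c) (mfderiv 𝓘(ℝ, ℝ) (𝓡 n) u c) := by
    have : 2 * c - c = c := by ring
    rw [this]; exact hd
  have h1 := HasMFDerivAt.comp c hd' hr.hasFDerivAt.hasMFDerivAt
  have h2 : u ∘ (fun s : ℝ => 2 * c - s) = u := funext h
  rw [h2] at h1
  have h3 := hasMFDerivAt_unique h1 hd
  have h4 : (mfderiv 𝓘(ℝ, ℝ) (𝓡 n) u c (-1 : ℝ) : EuclideanSpace ℝ (Fin n))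
      = mfderiv 𝓘(ℝ, ℝ) (𝓡 n) u c (1 : ℝ) :=
    (congrArg (mfderiv 𝓘(ℝ, ℝ) (𝓡 n) u c)
      (by simp : (-1 : ℝ) = ContinuousLinearMap.toSpanSingleton ℝ (-1 : ℝ) (1 : ℝ))).trans
      (DFunLike.congr_fun h3 (1 : ℝ))
  have h5 : mfderiv 𝓘(ℝ, ℝ) (𝓡 n) u c (1 : ℝ) = 0 := by
    have h6 : (mfderiv 𝓘(ℝ, ℝ) (𝓡 n) u c (-1 : ℝ)) = -mfderiv 𝓘(ℝ, ℝ) (𝓡 n) u c (1 : ℝ) :=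
      map_neg _ _
    have h7 : ∀ x : EuclideanSpace ℝ (Fin n), x = -x → x = 0 := fun x hx => by
      have h8 : (2 : ℝ) • x = 0 := by
        rw [two_smul]
        nth_rewrite 1 [hx]
        exact neg_add_cancel x
      simpa using h8
    exact h7 _ (h4.symm.trans h6)
  unfold speedSq
  rw [h5]
  simp

theorem eq_of_mfderiv_eq_zero {u : ℝ → M} (hu : ContMDiff 𝓘(ℝ, ℝ) (𝓡 n) ∞ u)
    (h : ∀ s, mfderiv 𝓘(ℝ, ℝ) (𝓡 n) u s = 0) (a b : ℝ) : u a = u b := by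
  refine IsLocallyConstant.apply_eq_of_preconnectedSpace
    ((IsLocallyConstant.iff_exists_open u).2 fun x => ?_) a b
  set e := chartAt (EuclideanSpace ℝ (Fin n)) (u x)
  have hnhds : u ⁻¹' e.source ∈ 𝓝 x :=
    hu.continuous.continuousAt (e.open_source.mem_nhds (mem_chart_source _ (u x)))
  obtain ⟨ε, hε, hball⟩ := Metric.mem_nhds_iff.1 hnhds
  refine ⟨Metric.ball x ε, Metric.isOpen_ball, Metric.mem_ball_self hε, fun y hy => ?_⟩
  have hder : ∀ z ∈ Metric.ball x ε,
      HasFDerivAt (e ∘ u) (0 : ℝ →L[ℝ] EuclideanSpace ℝ (Fin n)) z := by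
    intro z hz
    have h1 : HasMFDerivAt 𝓘(ℝ, ℝ) (𝓡 n) u z (mfderiv 𝓘(ℝ, ℝ) (𝓡 n) u z) :=
      (hu.mdifferentiableAt (by simp)).hasMFDerivAt
    have h2 := (mdifferentiableAt_atlas (I := 𝓡 n)
      (chart_mem_atlas (EuclideanSpace ℝ (Fin n)) (u x))
      (hball hz)).hasMFDerivAt.comp z h1
    rw [h z] at h2
    exact h2.hasFDerivAt.congr_fderiv (ContinuousLinearMap.comp_zero _)
  have := (convex_ball x ε).is_const_of_fderivWithin_eq_zero (𝕜 := ℝ) (f := e ∘ u)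
    (fun z hz => (hder z hz).differentiableAt.differentiableWithinAt)
    (fun z hz => by
      rw [fderivWithin_of_isOpen Metric.isOpen_ball hz, (hder z hz).fderiv])
    hy (Metric.mem_ball_self hε)
  exact e.injOn (hball hy) (hball (Metric.mem_ball_self hε)) this

theorem mfderiv_eq_zero_of_speedSq_eq_zero (g : RiemMetric n M) {u : ℝ → M} {s : ℝ}
    (h : speedSq g u s = 0) : mfderiv 𝓘(ℝ, ℝ) (𝓡 n) u s = 0 := by
  have h1 : mfderiv 𝓘(ℝ, ℝ) (𝓡 n) u s (1 : ℝ) = 0 := by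
    by_contra hne
    exact (g.pos (u s) _ hne).ne' h
  ext1
  exact h1

/-- A smooth curve with zero speed on `[0, π]` is constant there. -/
theorem eq_of_speedSq_eq_zero [T2Space M] (g : RiemMetric n M) {u : ℝ → M}
    (hu : ContMDiff 𝓘(ℝ, ℝ) (𝓡 n) ∞ u) (h : ∀ s ∈ Icc 0 Real.pi, speedSq g u s = 0) :
    ∀ s ∈ Icc 0 Real.pi, u s = u 0 := by
  -- reparametrize by `ℝ → (0, π)`, so that the speed vanishes on all of `ℝ`
  set ψ : ℝ → ℝ := fun x => Real.arctan x + Real.pi / 2 with hψ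
  have hψs : ContDiff ℝ ∞ ψ := Real.contDiff_arctan.add contDiff_const
  have hmem : ∀ x, ψ x ∈ Icc 0 Real.pi := fun x =>
    ⟨by have := Real.neg_pi_div_two_lt_arctan x; simp only [hψ]; linarith,
      by have := Real.arctan_lt_pi_div_two x; simp only [hψ]; linarith⟩
  have hconst := eq_of_mfderiv_eq_zero (hu.comp hψs.contMDiff) fun x =>
    mfderiv_eq_zero_of_speedSq_eq_zero g (by
      rw [speedSq_comp g hu ((hψs.differentiable (by simp) x).hasDerivAt), h _ (hmem x), mul_zero])
  have hIoo : ∀ s ∈ Ioo 0 Real.pi, u s = u (Real.pi / 2) := by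
    intro s hs
    have := hconst (Real.tan (s - Real.pi / 2)) 0
    simp only [Function.comp_apply, hψ, Real.arctan_zero, zero_add] at this
    rwa [Real.arctan_tan (by linarith [hs.1]) (by linarith [hs.2]), sub_add_cancel] at this
  have hcl : IsClosed {s | u s = u (Real.pi / 2)} := isClosed_eq hu.continuous continuous_const
  have hIcc : Icc 0 Real.pi ⊆ {s | u s = u (Real.pi / 2)} := by
    rw [← closure_Ioo Real.pi_pos.ne]
    exact hcl.closure_subset_iff.2 hIoo
  intro s hs
  exact (hIcc hs).trans (hIcc ⟨le_rfl, Real.pi_pos.le⟩).symm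

end

/-! ### `|df|²` in an orthonormal frame -/

section

/-- If `Pᵀ G P = c • 1` with `c ≠ 0`, the trace of `G⁻¹ Q` is that of `Pᵀ Q P`, up to `c`. -/
theorem trace_inv_mul_of_frame {G P : Matrix (Fin 2) (Fin 2) ℝ} {c : ℝ} (hc : c ≠ 0)
    (h : P.transpose * G * P = c • 1) (Q : Matrix (Fin 2) (Fin 2) ℝ) :
    (G⁻¹ * Q).trace = c⁻¹ * (P.transpose * Q * P).trace := by
  have h1 : (c⁻¹ • (P.transpose * G)) * P = 1 := by
    rw [Matrix.smul_mul, h, smul_smul, inv_mul_cancel₀ hc, one_smul]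
  have h2 := mul_eq_one_comm.1 h1
  have h3 : (c⁻¹ • (P * P.transpose)) * G = 1 := by
    rw [← h2, Matrix.smul_mul, Matrix.mul_smul, Matrix.mul_assoc]
  rw [Matrix.inv_eq_left_inv h3, Matrix.smul_mul, Matrix.trace_smul, Matrix.mul_assoc,
    Matrix.trace_mul_comm, smul_eq_mul]

/-- The matrix of a bilinear form in a new pair of vectors. -/
theorem bilin_frame (B : EuclideanSpace ℝ (Fin 2) →ₗ[ℝ] EuclideanSpace ℝ (Fin 2) →ₗ[ℝ] ℝ)
    (a : Fin 2 → EuclideanSpace ℝ (Fin 2)) (i j : Fin 2) :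
    ((Matrix.of fun k l => a l k).transpose * (Matrix.of fun k l =>
      B (EuclideanSpace.single k (1 : ℝ)) (EuclideanSpace.single l (1 : ℝ)))
      * (Matrix.of fun k l => a l k)) i j = B (a i) (a j) := by
  have h : ∀ x : EuclideanSpace ℝ (Fin 2), x = x 0 • EuclideanSpace.single 0 (1 : ℝ)
      + x 1 • EuclideanSpace.single 1 (1 : ℝ) := by
    intro x
    ext k
    fin_cases k <;> simp
  conv_rhs => rw [h (a i), h (a j)]
  simp only [Matrix.mul_apply, Fin.sum_univ_two, Matrix.transpose_apply, Matrix.of_apply, map_add,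
    map_smul, LinearMap.add_apply, LinearMap.smul_apply, smul_eq_mul]
  ring

variable {n : ℕ} {M : Type*} [TopologicalSpace M] [ChartedSpace (EuclideanSpace ℝ (Fin n)) M]

/-- The derivative of `f` along the velocity of a curve is the velocity of the image curve. -/
theorem mfderiv_comp_curve (f : MapS2 n M) {c : ℝ → S2} (hc : ContMDiff 𝓘(ℝ, ℝ) (𝓡 2) ∞ c) (s : ℝ) :
    mfderiv 𝓘(ℝ, ℝ) (𝓡 n) (f ∘ c) s (1 : ℝ)
      = mfderiv (𝓡 2) (𝓡 n) f (c s) (mfderiv 𝓘(ℝ, ℝ) (𝓡 2) c s (1 : ℝ)) := by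
  have h1 : HasMFDerivAt (𝓡 2) (𝓡 n) f (c s) (mfderiv (𝓡 2) (𝓡 n) f (c s)) :=
    (f.contMDiff.mdifferentiableAt (by simp)).hasMFDerivAt
  have h2 := h1.comp s (hc.mdifferentiableAt (by simp)).hasMFDerivAt
  rw [h2.mfderiv]
  rfl

variable [IsManifold (𝓡 n) ∞ M]

/-- `|df|²` computed in a pair of tangent vectors that is orthonormal in `ℝ³`. -/
theorem normSqDeriv_of_orthonormal (g : RiemMetric n M) (f : MapS2 n M) (p : S2)
    (a : Fin 2 → TangentSpace (𝓡 2) p)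
    (ha : ∀ i j, inner ℝ (inclDeriv p (a i)) (inclDeriv p (a j)) = if i = j then 1 else 0) :
    normSqDeriv g f p =
      4 * Real.pi * (pullback g f p (a 0) (a 0) + pullback g f p (a 1) (a 1)) := by
  let L₁ := inclDeriv p
  let k : ℝ := (4 * Real.pi)⁻¹
  let B₁ : EuclideanSpace ℝ (Fin 2) →ₗ[ℝ] EuclideanSpace ℝ (Fin 2) →ₗ[ℝ] ℝ :=
    LinearMap.mk₂ ℝ (fun v w => roundInner p v w)
      (fun v v' w => by
        change k * inner ℝ (L₁ (v + v')) (L₁ w)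
          = k * inner ℝ (L₁ v) (L₁ w) + k * inner ℝ (L₁ v') (L₁ w)
        rw [show L₁ (v + v') = L₁ v + L₁ v' from map_add L₁ v v', inner_add_left, mul_add])
      (fun c v w => by
        change k * inner ℝ (L₁ (c • v)) (L₁ w) = c * (k * inner ℝ (L₁ v) (L₁ w))
        rw [show L₁ (c • v) = c • L₁ v from map_smul L₁ c v, real_inner_smul_left, mul_left_comm])
      (fun v w w' => by
        change k * inner ℝ (L₁ v) (L₁ (w + w'))
          = k * inner ℝ (L₁ v) (L₁ w) + k * inner ℝ (L₁ v) (L₁ w')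
        rw [show L₁ (w + w') = L₁ w + L₁ w' from map_add L₁ w w', inner_add_right, mul_add])
      (fun c v w => by
        change k * inner ℝ (L₁ v) (L₁ (c • w)) = c * (k * inner ℝ (L₁ v) (L₁ w))
        rw [show L₁ (c • w) = c • L₁ w from map_smul L₁ c w, real_inner_smul_right, mul_left_comm])
  let L := mfderiv (𝓡 2) (𝓡 n) f p
  let B₂ : EuclideanSpace ℝ (Fin 2) →ₗ[ℝ] EuclideanSpace ℝ (Fin 2) →ₗ[ℝ] ℝ :=
    LinearMap.mk₂ ℝ (fun v w => pullback g f p v w)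
      (fun v v' w => by
        change g.inner (f p) (L (v + v')) (L w)
          = g.inner (f p) (L v) (L w) + g.inner (f p) (L v') (L w)
        rw [show L (v + v') = L v + L v' from map_add L v v', map_add]; rfl)
      (fun c v w => by
        change g.inner (f p) (L (c • v)) (L w) = c * g.inner (f p) (L v) (L w)
        rw [show L (c • v) = c • L v from map_smul L c v, map_smul]; rfl)
      (fun v w w' => by
        change g.inner (f p) (L v) (L (w + w'))
          = g.inner (f p) (L v) (L w) + g.inner (f p) (L v) (L w')
        rw [show L (w + w') = L w + L w' from map_add L w w', map_add])
      (fun c v w => by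
        change g.inner (f p) (L v) (L (c • w)) = c * g.inner (f p) (L v) (L w)
        rw [show L (c • w) = c • L w from map_smul L c w, map_smul]; rfl)
  have h1 := trace_inv_mul_of_frame (G := gram p)
    (P := Matrix.of fun k l => (show EuclideanSpace ℝ (Fin 2) from a l) k)
    (c := (4 * Real.pi)⁻¹) (by positivity) (by
      ext i j
      refine (bilin_frame B₁ a i j).trans ?_
      change (4 * Real.pi)⁻¹ * inner ℝ (inclDeriv p (a i)) (inclDeriv p (a j)) = _
      rw [ha]
      simp [Matrix.one_apply])
    (Matrix.of fun i j => pullback g f p (coordVec p i) (coordVec p j))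
  unfold normSqDeriv
  rw [h1, inv_inv, Matrix.trace_fin_two]
  congr 1
  exact congrArg₂ (· + ·) (bilin_frame B₂ a 0 0) (bilin_frame B₂ a 1 1)

/-- The unit-speed great circle `s ↦ cos s • v + sin s • e` from `v` in the direction of `e`. -/
noncomputable def meridian (v e : S2) (h : inner ℝ (v : R3) (e : R3) = 0) (s : ℝ) : S2 :=
  ⟨Real.cos s • (v : R3) + Real.sin s • (e : R3), by
    have hv : ‖(v : R3)‖ = 1 := norm_eq_of_mem_sphere v
    have he : ‖(e : R3)‖ = 1 := norm_eq_of_mem_sphere e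
    have : ‖Real.cos s • (v : R3) + Real.sin s • (e : R3)‖ ^ 2 = 1 := by
      rw [norm_add_sq_real, inner_smul_left, inner_smul_right, h, norm_smul, norm_smul, hv, he]
      simp
    rw [mem_sphere_zero_iff_norm]
    exact (pow_eq_one_iff_of_nonneg (norm_nonneg _) two_ne_zero).1 this⟩

theorem coe_meridian (v e : S2) (h : inner ℝ (v : R3) (e : R3) = 0) (s : ℝ) :
    (meridian v e h s : R3) = Real.cos s • (v : R3) + Real.sin s • (e : R3) := rfl

theorem fact_finrank_R3 : Fact (Module.finrank ℝ R3 = 2 + 1) := ⟨by simp⟩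

theorem contMDiff_meridian (v e : S2) (h : inner ℝ (v : R3) (e : R3) = 0) :
    ContMDiff 𝓘(ℝ, ℝ) (𝓡 2) ∞ (meridian v e h) := by
  have := fact_finrank_R3
  have h1 : ContDiff ℝ ∞ (fun s : ℝ => Real.cos s • (v : R3) + Real.sin s • (e : R3)) :=
    (Real.contDiff_cos.smul contDiff_const).add (Real.contDiff_sin.smul contDiff_const)
  exact h1.contMDiff.codRestrict_sphere fun s => (meridian v e h s).2

/-- The velocity of a curve on the sphere, seen in `ℝ³`. -/
theorem inclDeriv_mfderiv {c : ℝ → S2} (hc : ContMDiff 𝓘(ℝ, ℝ) (𝓡 2) ∞ c) {s : ℝ} {w : R3}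
    (hw : HasDerivAt (fun s => (c s : R3)) w s) :
    inclDeriv (c s) (mfderiv 𝓘(ℝ, ℝ) (𝓡 2) c s (1 : ℝ)) = w := by
  have := fact_finrank_R3
  have h1 : HasMFDerivAt (𝓡 2) 𝓘(ℝ, R3) ((↑) : S2 → R3) (c s) (inclDeriv (c s)) :=
    ((contMDiff_coe_sphere (m := ∞) (c s)).mdifferentiableAt (by simp)).hasMFDerivAt
  have h2 := h1.comp s (hc.mdifferentiableAt (by simp)).hasMFDerivAt
  have h3 := hasMFDerivAt_unique h2 hw.hasFDerivAt.hasMFDerivAt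
  have h4 := DFunLike.congr_fun h3 (1 : ℝ)
  refine h4.trans ?_
  change (1 : ℝ) • w = w
  exact one_smul _ _

theorem pullback_velocity (g : RiemMetric n M) (f : MapS2 n M) {c : ℝ → S2}
    (hc : ContMDiff 𝓘(ℝ, ℝ) (𝓡 2) ∞ c) (s : ℝ) :
    pullback g f (c s) (mfderiv 𝓘(ℝ, ℝ) (𝓡 2) c s (1 : ℝ)) (mfderiv 𝓘(ℝ, ℝ) (𝓡 2) c s (1 : ℝ))
      = speedSq g (f ∘ c) s := by
  unfold pullback speedSq
  rw [mfderiv_comp_curve f hc s]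
  rfl

end

/-! ### Axisymmetric maps and their energy -/

section

theorem inner_coe_self (p : S2) : inner ℝ (p : R3) (p : R3) = 1 := by
  rw [real_inner_self_eq_norm_sq, norm_eq_of_mem_sphere p, one_pow]

theorem cos_angleTo (v p : S2) : Real.cos (angleTo v p) = inner ℝ (v : R3) (p : R3) := by
  have h := abs_real_inner_le_norm (v : R3) (p : R3)
  rw [norm_eq_of_mem_sphere v, norm_eq_of_mem_sphere p, mul_one, abs_le] at h
  exact Real.cos_arccos h.1 h.2

theorem angleTo_mem_Icc (v p : S2) : angleTo v p ∈ Icc 0 Real.pi :=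
  ⟨Real.arccos_nonneg _, Real.arccos_le_pi _⟩

theorem inner_meridian (v e : S2) (h : inner ℝ (v : R3) (e : R3) = 0) (s : ℝ) :
    inner ℝ (v : R3) (meridian v e h s : R3) = Real.cos s := by
  rw [coe_meridian, inner_add_right, inner_smul_right, inner_smul_right, h, inner_coe_self]
  ring

/-- Two orthonormal vectors of `ℝ³` extend to an orthonormal triple. -/
theorem exists_third_orthonormal (v e : S2) (h : inner ℝ (v : R3) (e : R3) = 0) :
    ∃ w : S2, inner ℝ (v : R3) (w : R3) = 0 ∧ inner ℝ (e : R3) (w : R3) = 0 := by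
  obtain ⟨b, hb⟩ := Orthonormal.exists_orthonormalBasis_extension_of_card_eq
    (ι := Fin 3) (𝕜 := ℝ) (E := R3) (by simp) (v := ![(v : R3), e, 0]) (s := {0, 1}) (by
      rw [orthonormal_iff_ite]
      rintro ⟨i, hi⟩ ⟨j, hj⟩
      simp only [Subtype.mk.injEq]
      rcases hi with rfl | rfl <;> rcases hj with rfl | rfl <;>
      simp [h, (real_inner_comm _ _).trans h, norm_eq_of_mem_sphere])
  have h0 : b 0 = v := hb 0 (by simp)
  have h1 : b 1 = e := hb 1 (by simp)
  refine ⟨⟨b 2, by simp⟩, ?_, ?_⟩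
  · rw [← h0]; exact b.orthonormal.2 (by decide)
  · rw [← h1]; exact b.orthonormal.2 (by decide)

theorem exists_orthogonal (v : S2) : ∃ e : S2, inner ℝ (v : R3) (e : R3) = 0 := by
  obtain ⟨b, h0⟩ := exists_orthonormalBasis_zero_eq v
  refine ⟨⟨b 1, by simp⟩, ?_⟩
  rw [← h0]; exact b.orthonormal.2 (by decide)

/-- Every point other than the poles lies on a meridian, at parameter the angle to the pole. -/
theorem exists_meridian_eq (v p : S2) (hp : angleTo v p ∈ Ioo 0 Real.pi) :
    ∃ (e : S2) (h : inner ℝ (v : R3) (e : R3) = 0), meridian v e h (angleTo v p) = p := by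
  set s := angleTo v p
  have hs : 0 < Real.sin s := Real.sin_pos_of_mem_Ioo hp
  have hc : Real.cos s = inner ℝ (v : R3) (p : R3) := cos_angleTo v p
  have hnorm : ‖(p : R3) - Real.cos s • (v : R3)‖ = Real.sin s := by
    have : ‖(p : R3) - Real.cos s • (v : R3)‖ ^ 2 = Real.sin s ^ 2 := by
      rw [norm_sub_sq_real, inner_smul_right, real_inner_comm, ← hc, norm_smul,
        norm_eq_of_mem_sphere v, norm_eq_of_mem_sphere p, Real.sin_sq, Real.norm_eq_abs, mul_one,
        sq_abs]
      ring
    exact (pow_left_inj₀ (norm_nonneg _) hs.le two_ne_zero).1 this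
  refine ⟨⟨(Real.sin s)⁻¹ • ((p : R3) - Real.cos s • (v : R3)), ?_⟩, ?_, ?_⟩
  · rw [mem_sphere_zero_iff_norm, norm_smul, hnorm, norm_inv, Real.norm_of_nonneg hs.le,
      inv_mul_cancel₀ hs.ne']
  · change inner ℝ (v : R3) ((Real.sin s)⁻¹ • ((p : R3) - Real.cos s • (v : R3))) = 0
    rw [inner_smul_right, inner_sub_right, inner_smul_right, inner_coe_self, ← hc]
    ring
  · apply Subtype.ext
    rw [coe_meridian]
    change _ + Real.sin s • ((Real.sin s)⁻¹ • ((p : R3) - Real.cos s • (v : R3))) = _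
    rw [smul_smul, mul_inv_cancel₀ hs.ne', one_smul]
    abel

variable {n : ℕ} {M : Type*} [TopologicalSpace M] [ChartedSpace (EuclideanSpace ℝ (Fin n)) M]

/-- `f` is constant on the circles of latitude around the axis through `v`. -/
def IsAxisymmetric (v : S2) (f : MapS2 n M) : Prop :=
  ∀ p q : S2, inner ℝ (v : R3) (p : R3) = inner ℝ (v : R3) (q : R3) → f p = f q

variable [IsManifold (𝓡 n) ∞ M]

theorem exists_velocity (g : RiemMetric n M) (f : MapS2 n M) {c : ℝ → S2}
    (hc : ContMDiff 𝓘(ℝ, ℝ) (𝓡 2) ∞ c) {s : ℝ} {w : R3}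
    (hw : HasDerivAt (fun s => (c s : R3)) w s) {p : S2} (hp : c s = p) :
    ∃ a : TangentSpace (𝓡 2) p, inclDeriv p a = w ∧ pullback g f p a a = speedSq g (f ∘ c) s := by
  subst hp
  exact ⟨_, inclDeriv_mfderiv hc hw, pullback_velocity g f hc s⟩

theorem hasDerivAt_meridian (v e : S2) (h : inner ℝ (v : R3) (e : R3) = 0) (s : ℝ) :
    HasDerivAt (fun s => (meridian v e h s : R3))
      (-Real.sin s • (v : R3) + Real.cos s • (e : R3)) s :=
  ((Real.hasDerivAt_cos s).smul_const _).add ((Real.hasDerivAt_sin s).smul_const _)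

/-- Off the poles, `|df|²` of an axisymmetric map is the squared speed along a meridian, up to the
factor `4π` of the metric of area one. -/
theorem IsAxisymmetric.normSqDeriv_eq (g : RiemMetric n M) {f : MapS2 n M} {v : S2}
    (hf : IsAxisymmetric v f) (e₀ : S2) (h₀ : inner ℝ (v : R3) (e₀ : R3) = 0) (p : S2)
    (hp : angleTo v p ∈ Ioo 0 Real.pi) :
    normSqDeriv g f p = 4 * Real.pi * speedSq g (f ∘ meridian v e₀ h₀) (angleTo v p) := by
  obtain ⟨e, he, hpe⟩ := exists_meridian_eq v p hp
  set s := angleTo v p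
  obtain ⟨w, hvw, hew⟩ := exists_third_orthonormal v e he
  have hpw : inner ℝ (p : R3) (w : R3) = 0 := by
    rw [← hpe, coe_meridian, inner_add_left, inner_smul_left, inner_smul_left, hvw, hew]
    simp
  have hcurve : f ∘ meridian v e he = f ∘ meridian v e₀ h₀ := funext fun τ =>
    hf _ _ (by rw [inner_meridian, inner_meridian])
  -- the great circle through `p` orthogonal to the meridian has a height that is even in `τ`
  have hzero : speedSq g (f ∘ meridian p w hpw) 0 = 0 :=
    speedSq_eq_zero_of_reflection g (f.contMDiff.comp (contMDiff_meridian p w hpw)) fun τ =>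
      hf _ _ (by
        rw [coe_meridian, coe_meridian, inner_add_right, inner_add_right, inner_smul_right,
          inner_smul_right, inner_smul_right, inner_smul_right, hvw]
        simp)
  obtain ⟨a₀, ha₀, hs₀⟩ := exists_velocity g f (contMDiff_meridian v e he)
    (hasDerivAt_meridian v e he s) hpe
  obtain ⟨a₁, ha₁, hs₁⟩ := exists_velocity g f (contMDiff_meridian p w hpw)
    (hasDerivAt_meridian p w hpw 0) (p := p) (by apply Subtype.ext; simp [coe_meridian])
  have ha₁' : inclDeriv p a₁ = (w : R3) := ha₁.trans (by simp)
  have h01 : inner ℝ (-Real.sin s • (v : R3) + Real.cos s • (e : R3)) (w : R3) = 0 := by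
    rw [inner_add_left, inner_smul_left, inner_smul_left, hvw, hew]; simp
  rw [normSqDeriv_of_orthonormal g f p ![a₀, a₁]]
  · change 4 * Real.pi * (pullback g f p a₀ a₀ + pullback g f p a₁ a₁) = _
    rw [hs₀, hs₁, hzero, hcurve, add_zero]
  · intro i j
    fin_cases i <;> fin_cases j
    · change inner ℝ (inclDeriv p a₀) (inclDeriv p a₀) = _
      rw [ha₀]
      simp only [inner_add_left, inner_add_right, inner_smul_left, inner_smul_right, he,
        inner_coe_self, (real_inner_comm _ _).trans he]
      simp [← pow_two]
    · change inner ℝ (inclDeriv p a₀) (inclDeriv p a₁) = _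
      rw [ha₀, ha₁', h01]
      simp
    · change inner ℝ (inclDeriv p a₁) (inclDeriv p a₀) = _
      rw [ha₀, ha₁', real_inner_comm, h01]
      simp
    · change inner ℝ (inclDeriv p a₁) (inclDeriv p a₁) = _
      rw [ha₁', inner_coe_self]
      simp

theorem ae_angleTo_mem_Ioo (v : S2) : ∀ᵐ p ∂area, angleTo v p ∈ Ioo 0 Real.pi := by
  refine ae_of_ae_map (continuous_angleTo v).aemeasurable (p := fun s => s ∈ Ioo 0 Real.pi) ?_
  rw [map_angleTo_area]
  exact (withDensity_absolutelyContinuous _ _).ae_le (ae_restrict_mem measurableSet_Ioo)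

/-- The `α`-energy of an axisymmetric map is a one-dimensional integral along a meridian. -/
theorem IsAxisymmetric.energy_eq (g : RiemMetric n M) (α : ℝ) {f : MapS2 n M} {v : S2}
    (hf : IsAxisymmetric v f) (e : S2) (h : inner ℝ (v : R3) (e : R3) = 0) :
    energy g α f = 1 / 2 * (1 / 2 * ∫ s in (0 : ℝ)..Real.pi,
      (1 + 4 * Real.pi * speedSq g (f ∘ meridian v e h) s) ^ α * Real.sin s) - 1 / 2 := by
  have hsp : Continuous (speedSq g (f ∘ meridian v e h)) :=
    (contDiff_speedSq g (f.contMDiff.comp (contMDiff_meridian v e h))).continuous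
  have hG : Continuous fun s => (1 + 4 * Real.pi * speedSq g (f ∘ meridian v e h) s) ^ α :=
    (by fun_prop : Continuous fun s =>
      1 + 4 * Real.pi * speedSq g (f ∘ meridian v e h) s).rpow_const
      fun s => Or.inl (by have := speedSq_nonneg g (f ∘ meridian v e h) s; positivity)
  rw [← integral_comp_angleTo v hG]
  unfold energy
  congr 2
  refine integral_congr_ae ?_
  filter_upwards [ae_angleTo_mem_Ioo v] with p hp
  rw [density, hf.normSqDeriv_eq g e h p hp]

end

/-! ### Variations along the meridians -/

section

/-- The field `P(⟨v, x⟩) (v - ⟨v, x⟩ x)`, tangent to the sphere along the meridians. -/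
noncomputable def axialField (v : S2) (P : Polynomial ℝ) (x : R3) : R3 :=
  P.eval (inner ℝ (v : R3) x) • ((v : R3) - (inner ℝ (v : R3) x) • x)

theorem contDiff_axialField (v : S2) (P : Polynomial ℝ) : ContDiff ℝ ∞ (axialField v P) := by
  have hin : ContDiff ℝ ∞ fun x : R3 => inner ℝ (v : R3) x := contDiff_const.inner ℝ contDiff_id
  have hP := contDiff_polynomial_eval P
  exact (hP.comp hin).smul (contDiff_const.sub (hin.smul contDiff_id))

theorem inner_axialField (v p : S2) (P : Polynomial ℝ) :
    inner ℝ (v : R3) (axialField v P p) = P.eval (inner ℝ (v : R3) (p : R3)) *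
      (1 - inner ℝ (v : R3) (p : R3) ^ 2) := by
  rw [axialField, inner_smul_right, inner_sub_right, inner_smul_right, inner_coe_self]
  ring

theorem norm_sq_axialField (v p : S2) (P : Polynomial ℝ) :
    ‖axialField v P p‖ ^ 2 = P.eval (inner ℝ (v : R3) (p : R3)) ^ 2 *
      (1 - inner ℝ (v : R3) (p : R3) ^ 2) := by
  rw [axialField, norm_smul, mul_pow, norm_sub_sq_real, norm_smul, inner_smul_right,
    norm_eq_of_mem_sphere v, norm_eq_of_mem_sphere p, Real.norm_eq_abs, sq_abs, mul_one,
    Real.norm_eq_abs, sq_abs]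
  ring

theorem inner_axialField_self (v p : S2) (P : Polynomial ℝ) :
    inner ℝ (p : R3) (axialField v P p) = 0 := by
  rw [axialField, inner_smul_right, inner_sub_right, inner_smul_right, inner_coe_self,
    real_inner_comm]
  ring

/-- The variation of the identity of the sphere with velocity `axialField v P`:
move along the tangent line and project back radially. -/
noncomputable def bend (v : S2) (P : Polynomial ℝ) (t : ℝ) (p : S2) : S2 :=
  ⟨(√(1 + ‖t • axialField v P p‖ ^ 2))⁻¹ • ((p : R3) + t • axialField v P p), by
    have hsq : ‖(p : R3) + t • axialField v P p‖ ^ 2 = 1 + ‖t • axialField v P p‖ ^ 2 := by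
      rw [norm_add_sq_real, inner_smul_right, inner_axialField_self, norm_eq_of_mem_sphere p]
      ring
    have hpos : 0 < 1 + ‖t • axialField v P p‖ ^ 2 := by positivity
    rw [mem_sphere_zero_iff_norm, norm_smul, ← hsq, Real.sqrt_sq (norm_nonneg _), norm_inv,
      norm_norm, inv_mul_cancel₀]
    intro h0
    rw [h0] at hsq
    linarith⟩

theorem contMDiff_bend (v : S2) (P : Polynomial ℝ) :
    ContMDiff (𝓘(ℝ, ℝ).prod (𝓡 2)) (𝓡 2) ∞ fun q : ℝ × S2 => bend v P q.1 q.2 := by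
  have := fact_finrank_R3
  have hY : ContDiff ℝ ∞ fun q : ℝ × R3 => q.1 • axialField v P q.2 :=
    contDiff_fst.smul ((contDiff_axialField v P).comp contDiff_snd)
  have hΨ : ContDiff ℝ ∞ fun q : ℝ × R3 =>
      (√(1 + ‖q.1 • axialField v P q.2‖ ^ 2))⁻¹ • (q.2 + q.1 • axialField v P q.2) := by
    refine ContDiff.smul (ContDiff.inv ((contDiff_const.add (hY.norm_sq ℝ)).sqrt ?_) ?_)
      (contDiff_snd.add hY)
    · intro q; positivity
    · intro q; positivity
  have hincl : ContMDiff (𝓘(ℝ, ℝ).prod (𝓡 2)) 𝓘(ℝ, ℝ × R3) ∞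
      fun q : ℝ × S2 => (q.1, (q.2 : R3)) :=
    contMDiff_fst.prodMk_space (contMDiff_coe_sphere.comp contMDiff_snd)
  exact (hΨ.contMDiff.comp hincl).codRestrict_sphere fun q => (bend v P q.1 q.2).2

theorem contMDiff_bend_right (v : S2) (P : Polynomial ℝ) (t : ℝ) :
    ContMDiff (𝓡 2) (𝓡 2) ∞ (bend v P t) := by
  have h : ContMDiff (𝓡 2) (𝓘(ℝ, ℝ).prod (𝓡 2)) ∞ fun p : S2 => (t, p) :=
    contMDiff_const.prodMk contMDiff_id
  have h' := ContMDiff.comp (contMDiff_bend v P) h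
  exact h'

theorem bend_zero (v : S2) (P : Polynomial ℝ) (p : S2) : bend v P 0 p = p := by
  apply Subtype.ext
  simp [bend]

/-- The height of `bend v P t p` depends only on the height of `p`. -/
theorem inner_bend (v p : S2) (P : Polynomial ℝ) (t : ℝ) {z : ℝ}
    (hz : inner ℝ (v : R3) (p : R3) = z) :
    inner ℝ (v : R3) (bend v P t p : R3) = (√(1 + (t * P.eval z) ^ 2 * (1 - z ^ 2)))⁻¹ *
      (z + t * (P.eval z * (1 - z ^ 2))) := by
  change inner ℝ (v : R3) ((√(1 + ‖t • axialField v P p‖ ^ 2))⁻¹ •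
    ((p : R3) + t • axialField v P p)) = _
  rw [inner_smul_right, inner_add_right, inner_smul_right, inner_axialField, norm_smul, mul_pow,
    norm_sq_axialField, Real.norm_eq_abs, sq_abs, hz, ← mul_assoc, ← mul_pow]

/-- On a meridian the variation acts by `s ↦ s - arctan (t P(cos s) sin s)`. -/
theorem bend_meridian (v e : S2) (h : inner ℝ (v : R3) (e : R3) = 0) (P : Polynomial ℝ)
    (t s : ℝ) : bend v P t (meridian v e h s)
      = meridian v e h (s - Real.arctan (t * (P.eval (Real.cos s) * Real.sin s))) := by
  apply Subtype.ext
  have hz := inner_meridian v e h s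
  change (√(1 + ‖t • axialField v P (meridian v e h s)‖ ^ 2))⁻¹ •
    ((meridian v e h s : R3) + t • axialField v P (meridian v e h s)) = _
  rw [norm_smul, mul_pow, norm_sq_axialField, hz, Real.norm_eq_abs, sq_abs, axialField, hz,
    coe_meridian, coe_meridian, Real.cos_sub, Real.sin_sub, Real.cos_arctan, Real.sin_arctan]
  have hs : 1 - Real.cos s ^ 2 = Real.sin s ^ 2 := by rw [Real.sin_sq]
  have hx : t ^ 2 * (P.eval (Real.cos s) ^ 2 * (1 - Real.cos s ^ 2))
      = (t * (P.eval (Real.cos s) * Real.sin s)) ^ 2 := by rw [hs]; ring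
  rw [hx]
  set k := P.eval (Real.cos s)
  set N := √(1 + (t * (k * Real.sin s)) ^ 2)
  have hc : Real.cos s * Real.cos s = 1 - Real.sin s * Real.sin s := by
    have := Real.sin_sq_add_cos_sq s
    linarith
  match_scalars
  · linear_combination (-N⁻¹ * t * k) * hc
  · ring

variable {n : ℕ} {M : Type*} [TopologicalSpace M] [ChartedSpace (EuclideanSpace ℝ (Fin n)) M]

/-- The variation `f ∘ bend v P t` of a map `f`. -/
noncomputable def bendMap (v : S2) (P : Polynomial ℝ) (f : MapS2 n M) (t : ℝ) : MapS2 n M :=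
  ⟨fun p => f (bend v P t p), f.contMDiff.comp (contMDiff_bend_right v P t)⟩

theorem IsAxisymmetric.comp_bend {v : S2} {f : MapS2 n M} (hf : IsAxisymmetric v f)
    (P : Polynomial ℝ) (t : ℝ) : IsAxisymmetric v (bendMap v P f t) := fun p q hpq =>
  hf _ _ ((inner_bend v p P t hpq).trans (inner_bend v q P t rfl).symm)

variable [IsManifold (𝓡 n) ∞ M]

/-- An axisymmetric critical point of the `α`-energy is constant. -/
theorem IsAxisymmetric.const_of_isCritical [T2Space M] (g : RiemMetric n M) {α : ℝ}
    (hα : 1 < α) {f : MapS2 n M} (hcrit : IsCritical g α f) {v : S2} (hf : IsAxisymmetric v f) :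
    ∃ c : M, ∀ p, f p = c := by
  obtain ⟨e, he⟩ := exists_orthogonal v
  set c := meridian v e he
  have hc : ContMDiff 𝓘(ℝ, ℝ) (𝓡 2) ∞ c := contMDiff_meridian v e he
  have hu : ContMDiff 𝓘(ℝ, ℝ) (𝓡 n) ∞ (f ∘ c) := f.contMDiff.comp hc
  set r : ℝ → ℝ := fun s => 4 * Real.pi * speedSq g (f ∘ c) s with hr
  have hrs : ContDiff ℝ ∞ r := contDiff_const.mul (contDiff_speedSq g hu)
  have hr0 : ∀ s, 0 ≤ r s := fun s => by
    have := speedSq_nonneg g (f ∘ c) s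
    positivity
  -- `u = f ∘ c` is even about `0` and about `π`, since the height on the meridian is
  have hrefl : ∀ a, (∀ s, Real.cos (2 * a - s) = Real.cos s) → r a = 0 := fun a ha => by
    have := speedSq_eq_zero_of_reflection g hu (c := a) fun s =>
      hf _ _ (by rw [inner_meridian, inner_meridian, ha])
    simp only [hr, this, mul_zero]
  have hvanish : ∀ s ∈ Icc 0 Real.pi, r s = 0 := by
    refine eq_zero_of_bend_critical hα hrs hr0 (hrefl 0 fun s => by simp)
      (hrefl Real.pi fun s => by rw [Real.cos_two_pi_sub]) fun P κ hκ => ?_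
    have hκs : ContDiff ℝ ∞ κ := by
      rw [hκ]
      exact ((contDiff_polynomial_eval P).comp Real.contDiff_cos).mul Real.contDiff_sin
    have h1 := hcrit (bendMap v P f) (f.contMDiff.comp (contMDiff_bend v P))
      (ContMDiffMap.ext fun p => congrArg f (bend_zero v P p))
    have h2 : (fun t => energy g α (bendMap v P f t)) = fun t => 1 / 2 * (1 / 2 *
        ∫ s in (0 : ℝ)..Real.pi, (1 + (1 - t * deriv κ s / (1 + (t * κ s) ^ 2)) ^ 2
          * r (s - Real.arctan (t * κ s))) ^ α * Real.sin s) - 1 / 2 := by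
      funext t
      rw [(hf.comp_bend P t).energy_eq g α e he]
      congr 4
      funext s
      congr 3
      have hcomp : bendMap v P f t ∘ meridian v e he
          = (f ∘ c) ∘ fun s => s - Real.arctan (t * κ s) := by
        funext s
        rw [hκ]
        exact congrArg f (bend_meridian v e he P t s)
      have hψ : HasDerivAt (fun s => s - Real.arctan (t * κ s))
          (1 - t * deriv κ s / (1 + (t * κ s) ^ 2)) s := by
        have := (hasDerivAt_id s).sub
          (((hκs.differentiable (by simp) s).hasDerivAt.const_mul t).arctan)
        refine this.congr_deriv ?_
        ring
      rw [hcomp, speedSq_comp g hu hψ]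
      simp only [hr]
      ring
    rw [h2] at h1
    have h3 := (((hasDerivAt_bend_energy (α := α) hrs hκs hr0).const_mul (1 / 2)).const_mul
      (1 / 2)).sub_const (1 / 2)
    have h4 := h3.unique h1
    linarith
  have hsp : ∀ s ∈ Icc 0 Real.pi, speedSq g (f ∘ c) s = 0 := fun s hs => by
    have h1 := hvanish s hs
    have : 4 * Real.pi ≠ 0 := by positivity
    exact (mul_eq_zero.1 h1).resolve_left this
  have hconst := eq_of_speedSq_eq_zero g hu hsp
  refine ⟨f (c 0), fun p => ?_⟩
  refine Eq.trans ?_ (hconst _ (angleTo_mem_Icc v p))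
  exact hf _ _ (by rw [inner_meridian, cos_angleTo])

end

/-! ### Rotations and isotropies -/

section

theorem mem_isotropy_iff {n : ℕ} {M : Type*} [TopologicalSpace M]
    [ChartedSpace (EuclideanSpace ℝ (Fin n)) M] {f : MapS2 n M} {A : O3} :
    A ∈ isotropy f ↔ ∀ p, f (act A⁻¹ p) = f p := by
  rw [MulAction.mem_stabilizer_iff]
  exact ⟨fun h p => DFunLike.congr_fun h p, fun h => ContMDiffMap.ext h⟩

theorem apply_act_of_mem_isotropy {n : ℕ} {M : Type*} [TopologicalSpace M]
    [ChartedSpace (EuclideanSpace ℝ (Fin n)) M] {f : MapS2 n M} {A : O3} (hA : A ∈ isotropy f)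
    (p : S2) : f (act A p) = f p := by
  have h := mem_isotropy_iff.1 (inv_mem hA) p
  rwa [inv_inv] at h

/-- The reflection in the plane orthogonal to `w` reverses orientation. -/
theorem det_reflection_orthogonal {w : R3} (hw : w ≠ 0) :
    LinearMap.det ((Submodule.reflection (ℝ ∙ w)ᗮ).toLinearEquiv : R3 →ₗ[ℝ] R3) = -1 := by
  have h := Submodule.det_reflection (ℝ ∙ w)ᗮ
  rw [Submodule.orthogonal_orthogonal, finrank_span_singleton hw, pow_one] at h
  exact h

/-- Points of equal height are related by a rotation about the axis: compose the reflection
exchanging them with a reflection fixing the axis and the target. -/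
theorem exists_rotation_apply_eq (v p q : S2)
    (h : inner ℝ (v : R3) (p : R3) = inner ℝ (v : R3) (q : R3)) :
    ∃ A ∈ rotations v, act A p = q := by
  by_cases hpq : p = q
  · exact ⟨1, one_mem _, hpq⟩
  have hsub : (p : R3) - q ≠ 0 := fun h0 => hpq (Subtype.ext (sub_eq_zero.1 h0))
  obtain ⟨w, hw0, hvw, hqw⟩ : ∃ w : R3, w ≠ 0 ∧ inner ℝ w (v : R3) = 0 ∧
      inner ℝ w (q : R3) = 0 := by
    set K := Submodule.span ℝ ({(v : R3), (q : R3)} : Set R3)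
    have hK : Kᗮ ≠ ⊥ := by
      intro hbot
      have htop : K = ⊤ := by rwa [Submodule.orthogonal_eq_bot_iff] at hbot
      have hle : Module.finrank ℝ K ≤ 2 := by
        have := finrank_span_le_card (R := ℝ) ({(v : R3), (q : R3)} : Set R3)
        refine this.trans ?_
        rw [Set.toFinset_card]
        simpa using Finset.card_le_two (a := (v : R3)) (b := (q : R3))
      rw [htop, finrank_top] at hle
      simp at hle
    obtain ⟨w, hw, hw0⟩ := Submodule.exists_mem_ne_zero_of_ne_bot hK
    refine ⟨w, hw0, ?_, ?_⟩
    · exact (Submodule.mem_orthogonal' K w).1 hw _ (Submodule.subset_span (by simp))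
    · exact (Submodule.mem_orthogonal' K w).1 hw _ (Submodule.subset_span (by simp))
  set R₁ : O3 := Submodule.reflection (ℝ ∙ ((p : R3) - q))ᗮ
  set R₂ : O3 := Submodule.reflection (ℝ ∙ w)ᗮ
  have h1v : R₁ v = v := Submodule.reflection_mem_subspace_eq_self (by
    rw [Submodule.mem_orthogonal_singleton_iff_inner_right, inner_sub_left, real_inner_comm,
      real_inner_comm (v : R3), h, sub_self])
  have h1p : R₁ p = q := Submodule.reflection_sub (by
    rw [norm_eq_of_mem_sphere p, norm_eq_of_mem_sphere q])
  have h2v : R₂ v = v := Submodule.reflection_mem_subspace_eq_self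
    (Submodule.mem_orthogonal_singleton_iff_inner_right.2 hvw)
  have h2q : R₂ q = q := Submodule.reflection_mem_subspace_eq_self
    (Submodule.mem_orthogonal_singleton_iff_inner_right.2 hqw)
  refine ⟨R₂ * R₁, ⟨?_, ?_⟩, Subtype.ext ?_⟩
  · change R₂ (R₁ v) = v
    rw [h1v, h2v]
  · have := LinearMap.det_comp (R₂.toLinearEquiv : R3 →ₗ[ℝ] R3) (R₁.toLinearEquiv : R3 →ₗ[ℝ] R3)
    rw [det_reflection_orthogonal hw0, det_reflection_orthogonal hsub] at this
    refine Eq.trans this ?_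
    norm_num
  · change R₂ (R₁ p) = q
    rw [h1p, h2q]

theorem isAxisymmetric_of_rotations_le {n : ℕ} {M : Type*} [TopologicalSpace M]
    [ChartedSpace (EuclideanSpace ℝ (Fin n)) M] {f : MapS2 n M} {v : S2}
    (h : rotations v ≤ isotropy f) : IsAxisymmetric v f := fun p q hpq => by
  obtain ⟨A, hA, rfl⟩ := exists_rotation_apply_eq v p q hpq
  exact (apply_act_of_mem_isotropy (h hA) p).symm

/-- The rotation by the angle `θ` in the plane of `e` and `w`, about the axis through `v`, when
`v, e, w` is an orthonormal basis. -/
noncomputable def spin (v e w : R3) (θ : ℝ) (x : R3) : R3 :=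
  inner ℝ v x • v + inner ℝ e x • (Real.cos θ • e + Real.sin θ • w)
    + inner ℝ w x • (-Real.sin θ • e + Real.cos θ • w)

theorem sum_of_orthonormal_three (b : OrthonormalBasis (Fin 3) ℝ R3) (x : R3) :
    x = inner ℝ (b 0) x • b 0 + inner ℝ (b 1) x • b 1 + inner ℝ (b 2) x • b 2 := by
  have h := b.sum_repr' x
  rw [Fin.sum_univ_three] at h
  exact h.symm

theorem spin_zero (b : OrthonormalBasis (Fin 3) ℝ R3) (x : R3) :
    spin (b 0) (b 1) (b 2) 0 x = x := by
  conv_rhs => rw [sum_of_orthonormal_three b x]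
  simp [spin]

theorem spin_spin (b : OrthonormalBasis (Fin 3) ℝ R3) (θ φ : ℝ) (x : R3) :
    spin (b 0) (b 1) (b 2) θ (spin (b 0) (b 1) (b 2) φ x)
      = spin (b 0) (b 1) (b 2) (θ + φ) x := by
  have ho : ∀ i j, inner ℝ (b i) (b j) = if i = j then (1 : ℝ) else 0 :=
    fun i j => b.inner_eq_ite i j
  simp only [spin, inner_add_right, inner_smul_right, ho, Real.cos_add, Real.sin_add]
  simp only [Fin.isValue, reduceIte, Fin.reduceEq, mul_zero, mul_one, add_zero, zero_add]
  match_scalars <;> ring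

theorem det_eq_one_or_neg_one (A : O3) :
    LinearMap.det (A.toLinearEquiv : R3 →ₗ[ℝ] R3) = 1 ∨
      LinearMap.det (A.toLinearEquiv : R3 →ₗ[ℝ] R3) = -1 := by
  set b := EuclideanSpace.basisFun (Fin 3) ℝ
  have h := b.det_to_matrix_orthonormalBasis_real (b.map A)
  have h2 : b.toBasis.det (b.map A) = LinearMap.det (A.toLinearEquiv : R3 →ₗ[ℝ] R3) := by
    have := b.toBasis.det_comp (A.toLinearEquiv : R3 →ₗ[ℝ] R3) b
    have h3 : b.toBasis.det b = 1 := by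
      rw [← b.coe_toBasis]; exact b.toBasis.det_self
    rw [h3, mul_one] at this
    rw [← this]
    congr 1
  rwa [h2] at h

/-- A rotation of `ℝ³` has an axis: `det (A - 1) = det Aᵀ det (A - 1) = det (1 - A)ᵀ`, which is
`-det (A - 1)` in odd dimension. -/
theorem exists_fixed_unit_vector (A : O3)
    (hA : LinearMap.det (A.toLinearEquiv : R3 →ₗ[ℝ] R3) = 1) : ∃ v : S2, A v = v := by
  set b := EuclideanSpace.basisFun (Fin 3) ℝ
  set L : R3 →ₗ[ℝ] R3 := (A.toLinearEquiv : R3 →ₗ[ℝ] R3)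
  set m := LinearMap.toMatrix b.toBasis b.toBasis L
  have hm : m.transpose * m = 1 := by
    ext i j
    have h1 : ∀ k l, m k l = inner ℝ (b k) (A (b l)) := fun k l => by
      simp only [m, LinearMap.toMatrix_apply, b.coe_toBasis, b.coe_toBasis_repr_apply,
        b.repr_apply_apply]
      rfl
    simp only [Matrix.mul_apply, Matrix.transpose_apply, h1]
    have h2 := b.sum_inner_mul_inner (A (b i)) (A (b j))
    simp_rw [real_inner_comm (b _) (A (b i))]  at h2
    rw [h2, A.inner_map_map, b.inner_eq_ite, Matrix.one_apply]
  have hdet : m.det = 1 := by rw [LinearMap.det_toMatrix]; exact hA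
  have h1 : (m - 1).det = 0 := by
    have h2 : (m.transpose * (m - 1)).det = (m - 1).det := by
      rw [Matrix.det_mul, Matrix.det_transpose, hdet, one_mul]
    have h3 : m.transpose * (m - 1) = (-(m - 1)).transpose := by
      rw [mul_sub, hm, mul_one, neg_sub, Matrix.transpose_sub, Matrix.transpose_one]
    rw [h3, Matrix.det_transpose, Matrix.det_neg] at h2
    simp only [Fintype.card_fin] at h2
    linarith
  have h4 : LinearMap.det (L - 1) = 0 := by
    rw [← LinearMap.det_toMatrix b.toBasis, map_sub, LinearMap.toMatrix_one]
    exact h1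
  obtain ⟨x, hx, hx0⟩ := Submodule.exists_mem_ne_zero_of_ne_bot
    (LinearMap.bot_lt_ker_of_det_eq_zero h4).ne'
  have hAx : A x = x := sub_eq_zero.1 (LinearMap.mem_ker.1 hx)
  refine ⟨⟨‖x‖⁻¹ • x, by simp [norm_smul, hx0]⟩, ?_⟩
  change A (‖x‖⁻¹ • x) = ‖x‖⁻¹ • x
  rw [map_smul, hAx]

end

/-! ### Infinite isotropy groups -/

section

theorem exists_nonneg_angle {x y : ℝ} (h : x ^ 2 + y ^ 2 = 1) :
    ∃ φ : ℝ, 0 ≤ φ ∧ Real.cos φ = x ∧ Real.sin φ = y := by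
  have hx : -1 ≤ x ∧ x ≤ 1 :=
    abs_le.1 (abs_le_one_iff_mul_self_le_one.2 (by nlinarith [sq_nonneg y]))
  have hs : Real.sin (Real.arccos x) = |y| := by
    rw [Real.sin_arccos, ← Real.sqrt_sq_eq_abs]; congr 1; linarith
  rcases le_total 0 y with hy | hy
  · exact ⟨Real.arccos x, Real.arccos_nonneg x, Real.cos_arccos hx.1 hx.2,
      by rw [hs, abs_of_nonneg hy]⟩
  · refine ⟨2 * Real.pi - Real.arccos x, ?_, ?_, ?_⟩
    · linarith [Real.arccos_le_pi x, Real.pi_pos]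
    · rw [Real.cos_two_pi_sub, Real.cos_arccos hx.1 hx.2]
    · rw [Real.sin_two_pi_sub, hs, abs_of_nonpos hy, neg_neg]

/-- A rotation is, in an orthonormal basis starting with its axis, given by `spin` with an angle
in `[0, π]`. -/
theorem exists_eq_spin (A : O3) (hA : LinearMap.det (A.toLinearEquiv : R3 →ₗ[ℝ] R3) = 1) :
    ∃ (b : OrthonormalBasis (Fin 3) ℝ R3) (θ : ℝ), θ ∈ Icc 0 Real.pi ∧
      ∀ x, A x = spin (b 0) (b 1) (b 2) θ x := by
  obtain ⟨v, hv⟩ := exists_fixed_unit_vector A hA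
  have key : ∀ b : OrthonormalBasis (Fin 3) ℝ R3, b 0 = v →
      inner ℝ (b 2) (A (b 2)) = inner ℝ (b 1) (A (b 1)) ∧
      inner ℝ (b 1) (A (b 2)) = -inner ℝ (b 2) (A (b 1)) ∧
      inner ℝ (b 1) (A (b 1)) ^ 2 + inner ℝ (b 2) (A (b 1)) ^ 2 = 1 ∧
      A (b 1) = inner ℝ (b 1) (A (b 1)) • b 1 + inner ℝ (b 2) (A (b 1)) • b 2 ∧
      A (b 2) = inner ℝ (b 1) (A (b 2)) • b 1 + inner ℝ (b 2) (A (b 2)) • b 2 := by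
    intro b hb
    have hA0 : A (b 0) = b 0 := by rw [hb]; exact hv
    have ho : ∀ i j, inner ℝ (b i) (b j) = if i = j then (1 : ℝ) else 0 :=
      fun i j => b.inner_eq_ite i j
    have hoA : ∀ i j, inner ℝ (A (b i)) (A (b j)) = if i = j then (1 : ℝ) else 0 :=
      fun i j => (A.inner_map_map _ _).trans (ho i j)
    have h01 : inner ℝ (b 0) (A (b 1)) = 0 := by
      have := hoA 0 1; rw [hA0] at this; simpa using this
    have h02 : inner ℝ (b 0) (A (b 2)) = 0 := by
      have := hoA 0 2; rw [hA0] at this; simpa using this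
    have e1 := sum_of_orthonormal_three b (A (b 1))
    have e2 := sum_of_orthonormal_three b (A (b 2))
    rw [h01, zero_smul, zero_add] at e1
    rw [h02, zero_smul, zero_add] at e2
    have hd : inner ℝ (b 1) (A (b 1)) * inner ℝ (b 2) (A (b 2))
        - inner ℝ (b 1) (A (b 2)) * inner ℝ (b 2) (A (b 1)) = 1 := by
      have hm : ∀ k l, LinearMap.toMatrix b.toBasis b.toBasis (A.toLinearEquiv : R3 →ₗ[ℝ] R3) k l
          = inner ℝ (b k) (A (b l)) := fun k l => by
        simp only [LinearMap.toMatrix_apply, b.coe_toBasis, b.coe_toBasis_repr_apply,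
          b.repr_apply_apply]
        rfl
      rw [← LinearMap.det_toMatrix b.toBasis, Matrix.det_fin_three] at hA
      simp only [hm, hA0, ho, h01, h02] at hA
      simp at hA
      linarith
    have q1 := hoA 1 1
    have q2 := hoA 2 2
    rw [e1] at q1
    rw [e2] at q2
    simp only [inner_add_left, inner_add_right, inner_smul_left, inner_smul_right, ho] at q1 q2
    simp at q1 q2
    set c := inner ℝ (b 1) (A (b 1))
    set s := inner ℝ (b 2) (A (b 1))
    set c' := inner ℝ (b 1) (A (b 2))
    set d := inner ℝ (b 2) (A (b 2))
    -- the two columns are unit vectors spanning area `1`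
    have hsum : (d - c) ^ 2 + (c' + s) ^ 2 = 0 := by nlinarith
    have hdc : d - c = 0 := by nlinarith [sq_nonneg (d - c), sq_nonneg (c' + s)]
    have hcs : c' + s = 0 := by nlinarith [sq_nonneg (d - c), sq_nonneg (c' + s)]
    exact ⟨by linarith, by linarith, by nlinarith, e1, e2⟩
  obtain ⟨b, hb, hs⟩ : ∃ b : OrthonormalBasis (Fin 3) ℝ R3, b 0 = v ∧
      0 ≤ inner ℝ (b 2) (A (b 1)) := by
    obtain ⟨b, hb0⟩ := exists_orthonormalBasis_zero_eq v
    rcases le_total 0 (inner ℝ (b 2) (A (b 1))) with h | h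
    · exact ⟨b, hb0, h⟩
    -- exchanging the last two basis vectors reverses the angle
    · refine ⟨b.reindex (Equiv.swap 1 2), ?_, ?_⟩
      · simpa [Equiv.swap_apply_of_ne_of_ne] using hb0
      · have := (key b hb0).2.1
        simp only [OrthonormalBasis.reindex_apply, Equiv.symm_swap, Equiv.swap_apply_left,
          Equiv.swap_apply_right]
        linarith
  obtain ⟨h22, h12, hsq, e1, e2⟩ := key b hb
  have hA0 : A (b 0) = b 0 := by rw [hb]; exact hv
  have hc : -1 ≤ inner ℝ (b 1) (A (b 1)) ∧ inner ℝ (b 1) (A (b 1)) ≤ 1 :=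
    abs_le.1 (abs_le_one_iff_mul_self_le_one.2 (by nlinarith [sq_nonneg (inner ℝ (b 2) (A (b 1)))]))
  refine ⟨b, Real.arccos (inner ℝ (b 1) (A (b 1))),
    ⟨Real.arccos_nonneg _, Real.arccos_le_pi _⟩, fun x => ?_⟩
  have hsin : Real.sin (Real.arccos (inner ℝ (b 1) (A (b 1)))) = inner ℝ (b 2) (A (b 1)) := by
    rw [Real.sin_arccos, ← Real.sqrt_sq hs]; congr 1; linarith
  rw [spin, hsin, Real.cos_arccos hc.1 hc.2]
  nth_rewrite 1 [sum_of_orthonormal_three b x]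
  rw [h22, h12] at e2
  rw [map_add, map_add, map_smul, map_smul, map_smul, hA0, ← e1, ← e2]

/-- An infinite subgroup of `O(3)` contains rotations arbitrarily close to the identity. -/
theorem exists_seq_tendsto_one {G : Subgroup O3} (hG : Infinite G) :
    ∃ (A : ℕ → O3) (δ : ℕ → ℝ), Tendsto δ atTop (𝓝 0) ∧ ∀ k, A k ∈ G ∧ A k ≠ 1 ∧
      LinearMap.det ((A k).toLinearEquiv : R3 →ₗ[ℝ] R3) = 1 ∧ ∀ x, ‖A k x - x‖ ≤ δ k * ‖x‖ := by
  set ι : O3 → (R3 →L[ℝ] R3) := fun A => (A.toContinuousLinearEquiv : R3 →L[ℝ] R3) with hι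
  have hιapp : ∀ A x, ι A x = A x := fun A x => rfl
  have hball : ∀ A, ι A ∈ Metric.closedBall (0 : R3 →L[ℝ] R3) 1 := fun A => by
    rw [mem_closedBall_zero_iff]
    exact ContinuousLinearMap.opNorm_le_bound _ zero_le_one fun x => by
      rw [hιapp, LinearIsometryEquiv.norm_map, one_mul]
  set a : ℕ → G := ⇑(Infinite.natEmbedding G)
  have hainj : Function.Injective a := (Infinite.natEmbedding G).injective
  obtain ⟨L, -, φ, hφ, hL⟩ := (isCompact_closedBall (0 : R3 →L[ℝ] R3) 1).tendsto_subseq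
    (fun k => hball (a k : O3))
  set B : ℕ → O3 := fun k => (a (φ k) : O3)⁻¹ * (a (φ (k + 1)) : O3) with hB
  have hBG : ∀ k, B k ∈ G := fun k => G.mul_mem (G.inv_mem (a (φ k)).2) (a (φ (k + 1))).2
  have hB1 : ∀ k, B k ≠ 1 := fun k h => by
    have h2 : (a (φ k) : O3) = a (φ (k + 1)) := inv_mul_eq_one.1 h
    exact (hφ (Nat.lt_succ_self k)).ne (hainj (Subtype.ext h2))
  have hdiff : Tendsto (fun k => ‖ι (B k) - 1‖) atTop (𝓝 0) := by
    have h1 : Tendsto (fun k => ‖ι (a (φ (k + 1))) - ι (a (φ k))‖) atTop (𝓝 0) := by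
      have := ((hL.comp (tendsto_add_atTop_nat 1)).sub hL).norm
      simpa using this
    refine squeeze_zero (fun _ => norm_nonneg _) (fun k => ?_) h1
    refine ContinuousLinearMap.opNorm_le_bound _ (norm_nonneg _) fun x => ?_
    have h2 : (ι (B k) - 1) x = (a (φ k) : O3).symm ((ι (a (φ (k + 1))) - ι (a (φ k))) x) := by
      change (a (φ k) : O3).symm ((a (φ (k + 1)) : O3) x) - x
        = (a (φ k) : O3).symm ((a (φ (k + 1)) : O3) x - (a (φ k) : O3) x)
      rw [map_sub, LinearIsometryEquiv.symm_apply_apply]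
    rw [h2, LinearIsometryEquiv.norm_map]
    exact ContinuousLinearMap.le_opNorm _ _
  have hdet : Tendsto (fun k => (ι (B k)).det) atTop (𝓝 1) := by
    have h1 : Tendsto (fun k => ι (B k)) atTop (𝓝 1) :=
      tendsto_iff_norm_sub_tendsto_zero.2 hdiff
    have h2 := (ContinuousLinearMap.continuous_det (𝕜 := ℝ) (E := R3)).tendsto 1
    have h3 : (1 : R3 →L[ℝ] R3).det = 1 := LinearMap.det_id
    rw [h3] at h2
    exact h2.comp h1
  obtain ⟨N, hN⟩ := eventually_atTop.1 (hdet.eventually (lt_mem_nhds (zero_lt_one' ℝ)))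
  refine ⟨fun k => B (k + N), fun k => ‖ι (B (k + N)) - 1‖,
    hdiff.comp (tendsto_add_atTop_nat N), fun k => ⟨hBG _, hB1 _, ?_, fun x => ?_⟩⟩
  · rcases det_eq_one_or_neg_one (B (k + N)) with h | h
    · exact h
    · have h1 : 0 < LinearMap.det ((B (k + N)).toLinearEquiv : R3 →ₗ[ℝ] R3) :=
        hN (k + N) (Nat.le_add_left _ _)
      rw [h] at h1
      norm_num at h1
  · exact (ι (B (k + N)) - 1).le_opNorm x

theorem pow_apply_eq_spin {A : O3} {b : OrthonormalBasis (Fin 3) ℝ R3} {θ : ℝ}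
    (h : ∀ x, A x = spin (b 0) (b 1) (b 2) θ x) (k : ℕ) (x : R3) :
    (A ^ k) x = spin (b 0) (b 1) (b 2) (k * θ) x := by
  induction k with
  | zero => simp [spin_zero]
  | succ k ih =>
    rw [pow_succ']
    change A ((A ^ k) x) = _
    rw [h, ih, spin_spin]
    congr 1
    push_cast
    ring

/-- Points of equal height are related by a rotation about the axis by a nonnegative angle. -/
theorem exists_spin_apply_eq (b : OrthonormalBasis (Fin 3) ℝ R3) (p q : S2)
    (h : inner ℝ (b 0) (p : R3) = inner ℝ (b 0) (q : R3)) :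
    ∃ φ : ℝ, 0 ≤ φ ∧ spin (b 0) (b 1) (b 2) φ p = q := by
  have hsq : ∀ r : S2, inner ℝ (b 0) (r : R3) ^ 2 + inner ℝ (b 1) (r : R3) ^ 2
      + inner ℝ (b 2) (r : R3) ^ 2 = 1 := fun r => by
    have := b.sum_sq_inner_right (r : R3)
    rw [Fin.sum_univ_three, norm_eq_of_mem_sphere r, one_pow] at this
    exact this
  have hp := hsq p
  have hq := hsq q
  have hqe := sum_of_orthonormal_three b (q : R3)
  rw [h] at hp
  set z := inner ℝ (b 0) (q : R3)
  set p₁ := inner ℝ (b 1) (p : R3) with hp₁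
  set p₂ := inner ℝ (b 2) (p : R3) with hp₂
  set q₁ := inner ℝ (b 1) (q : R3)
  set q₂ := inner ℝ (b 2) (q : R3)
  obtain ⟨φ, hφ, h1, h2⟩ : ∃ φ : ℝ, 0 ≤ φ ∧ Real.cos φ * p₁ - Real.sin φ * p₂ = q₁ ∧
      Real.sin φ * p₁ + Real.cos φ * p₂ = q₂ := by
    by_cases hρ : p₁ ^ 2 + p₂ ^ 2 = 0
    · have hρ' : q₁ ^ 2 + q₂ ^ 2 = 0 := by linarith
      have a1 : p₁ = 0 := by nlinarith [sq_nonneg p₁, sq_nonneg p₂]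
      have a2 : p₂ = 0 := by nlinarith [sq_nonneg p₁, sq_nonneg p₂]
      have a3 : q₁ = 0 := by nlinarith [sq_nonneg q₁, sq_nonneg q₂]
      have a4 : q₂ = 0 := by nlinarith [sq_nonneg q₁, sq_nonneg q₂]
      exact ⟨0, le_rfl, by rw [a1, a2, a3]; ring, by rw [a1, a2, a4]; ring⟩
    · have hρq : q₁ ^ 2 + q₂ ^ 2 = p₁ ^ 2 + p₂ ^ 2 := by linarith
      obtain ⟨φ, hφ, hc, hs⟩ := exists_nonneg_angle (x := (p₁ * q₁ + p₂ * q₂) / (p₁ ^ 2 + p₂ ^ 2))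
        (y := (p₁ * q₂ - p₂ * q₁) / (p₁ ^ 2 + p₂ ^ 2)) (by
          field_simp
          linear_combination (p₁ ^ 2 + p₂ ^ 2) * hρq)
      refine ⟨φ, hφ, ?_, ?_⟩
      · rw [hc, hs]; field_simp; ring
      · rw [hc, hs]; field_simp; ring
  refine ⟨φ, hφ, ?_⟩
  rw [hqe, spin, h, ← h1, ← h2, ← hp₁, ← hp₂]
  match_scalars <;> ring

/-- A smooth map with infinite isotropy is axisymmetric: powers of isotropies close to the identity
approximate every rotation about a limit of their axes. -/
theorem exists_isAxisymmetric_of_infinite {n : ℕ} {M : Type*} [TopologicalSpace M] [T2Space M]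
    [ChartedSpace (EuclideanSpace ℝ (Fin n)) M] {f : MapS2 n M} (h : Infinite (isotropy f)) :
    ∃ v : S2, IsAxisymmetric v f := by
  obtain ⟨A, δ, hδ, hA⟩ := exists_seq_tendsto_one h
  choose b θ hθ hspin using fun k => exists_eq_spin (A k) (hA k).2.2.1
  have hθpos : ∀ k, 0 < θ k := fun k => by
    refine lt_of_le_of_ne (hθ k).1 fun h0 => (hA k).2.1 (LinearIsometryEquiv.ext fun x => ?_)
    rw [hspin, ← h0, spin_zero]
    rfl
  have hθ0 : Tendsto θ atTop (𝓝 0) := by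
    have hcos : Tendsto (fun k => Real.cos (θ k)) atTop (𝓝 1) := by
      have hbound : ∀ k, |Real.cos (θ k) - 1| ≤ δ k := fun k => by
        have h1 : Real.cos (θ k) - 1 = inner ℝ (b k 1) (A k (b k 1) - b k 1) := by
          have ho : ∀ i j, inner ℝ (b k i) (b k j) = if i = j then (1 : ℝ) else 0 :=
            fun i j => (b k).inner_eq_ite i j
          rw [hspin, spin]
          simp only [inner_sub_right, inner_add_right, inner_smul_right, ho]
          simp
        rw [h1]
        refine (abs_real_inner_le_norm _ _).trans ?_
        have := (hA k).2.2.2 (b k 1)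
        rw [(b k).norm_eq_one, mul_one] at this
        rw [(b k).norm_eq_one, one_mul]
        exact this
      rw [tendsto_iff_norm_sub_tendsto_zero]
      exact squeeze_zero (fun _ => norm_nonneg _) hbound hδ
    have h2 := (Real.continuous_arccos.tendsto 1).comp hcos
    rw [Real.arccos_one] at h2
    refine h2.congr fun k => ?_
    exact Real.arccos_cos (hθ k).1 (hθ k).2
  obtain ⟨y, ψ, hψ, hy⟩ := CompactSpace.tendsto_subseq
    (fun k => (fun i => ⟨b k i, by simp⟩ : Fin 3 → S2))
  have hyi : ∀ i, Tendsto (fun k => b (ψ k) i) atTop (𝓝 (y i : R3)) := fun i =>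
    (continuous_subtype_val.tendsto _).comp ((continuous_apply i).continuousAt.tendsto.comp hy)
  have hyo : Orthonormal ℝ fun i => (y i : R3) := by
    rw [orthonormal_iff_ite]
    intro i j
    refine tendsto_nhds_unique ((hyi i).inner (hyi j)) ?_
    refine tendsto_const_nhds.congr fun k => ?_
    exact ((b (ψ k)).inner_eq_ite i j).symm
  obtain ⟨c, hc⟩ := Orthonormal.exists_orthonormalBasis_extension_of_card_eq
    (ι := Fin 3) (𝕜 := ℝ) (E := R3) (by simp) (v := fun i => (y i : R3)) (s := univ)
    (hyo.comp _ Subtype.val_injective)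
  have hcy : ∀ i, c i = y i := fun i => hc i (mem_univ i)
  refine ⟨y 0, fun p q hpq => ?_⟩
  obtain ⟨φ, hφ, hφq⟩ := exists_spin_apply_eq c p q (by rw [hcy]; exact hpq)
  -- multiples of the small angles `θ k` that converge to `φ`
  set m : ℕ → ℕ := fun k => ⌊φ / θ k⌋₊
  have hm : Tendsto (fun k => (m k : ℝ) * θ k) atTop (𝓝 φ) := by
    rw [tendsto_iff_norm_sub_tendsto_zero]
    refine squeeze_zero (fun _ => norm_nonneg _) (fun k => ?_) hθ0
    have h1 := Nat.floor_le (div_nonneg hφ (hθpos k).le)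
    have h2 := Nat.lt_floor_add_one (φ / θ k)
    rw [le_div_iff₀ (hθpos k)] at h1
    rw [div_lt_iff₀ (hθpos k)] at h2
    rw [Real.norm_eq_abs, abs_le]
    constructor <;> linarith
  have hlim : Tendsto (fun k => act (A (ψ k) ^ m (ψ k)) p) atTop (𝓝 q) := by
    rw [tendsto_subtype_rng]
    have h1 : ∀ k, (act (A (ψ k) ^ m (ψ k)) p : R3)
        = spin (b (ψ k) 0) (b (ψ k) 1) (b (ψ k) 2) (m (ψ k) * θ (ψ k)) p := fun k =>
      pow_apply_eq_spin (hspin (ψ k)) _ _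
    simp_rw [h1]
    rw [← hφq, hcy, hcy, hcy]
    have hmψ := hm.comp hψ.tendsto_atTop
    have hcosl := (Real.continuous_cos.tendsto φ).comp hmψ
    have hsinl := (Real.continuous_sin.tendsto φ).comp hmψ
    have hin : ∀ i, Tendsto (fun k => inner ℝ (b (ψ k) i) (p : R3)) atTop
        (𝓝 (inner ℝ (y i : R3) (p : R3))) := fun i => (hyi i).inner tendsto_const_nhds
    exact (((hin 0).smul (hyi 0)).add ((hin 1).smul ((hcosl.smul (hyi 1)).add
      (hsinl.smul (hyi 2))))).add ((hin 2).smul ((hsinl.neg.smul (hyi 1)).add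
      (hcosl.smul (hyi 2))))
  have hconst : ∀ k, f (act (A (ψ k) ^ m (ψ k)) p) = f p := fun k =>
    apply_act_of_mem_isotropy ((isotropy f).pow_mem (hA (ψ k)).1 _) p
  have h1 := (f.contMDiff.continuous.tendsto q).comp hlim
  refine tendsto_nhds_unique (tendsto_const_nhds.congr fun k => (hconst k).symm) h1

end

end AlphaEnergy

open AlphaEnergy in
theorem lemma3p1 {n : ℕ} {M : Type*} [TopologicalSpace M] [T2Space M] [CompactSpace M]
    [ChartedSpace (EuclideanSpace ℝ (Fin n)) M] [IsManifold (𝓡 n) ∞ M]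
    (g : RiemMetric n M) (α : ℝ) (hα : 1 < α)
    (f : MapS2 n M) (hcrit : IsCritical g α f) (hfin : HasFiniteEnergy g α f) :
    (((∃ c : M, ∀ p, f p = c) ∧ isotropy f = ⊤) ∨ Finite (isotropy f)) ∧
      ((¬ ∃ c : M, ∀ p, f p = c) → ∀ v : S2, ¬ rotations v ≤ isotropy f) := by
  refine ⟨?_, fun hne v hv =>
    hne ((isAxisymmetric_of_rotations_le hv).const_of_isCritical g hα hcrit)⟩
  rcases finite_or_infinite (isotropy f) with hfinite | hinf
  · exact Or.inr hfinite
  · obtain ⟨v, hv⟩ := exists_isAxisymmetric_of_infinite hinf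
    obtain ⟨c, hc⟩ := hv.const_of_isCritical g hα hcrit
    refine Or.inl ⟨⟨c, hc⟩, (Subgroup.eq_top_iff' _).2 fun A => ?_⟩
    exact mem_isotropy_iff.2 fun p => (hc _).trans (hc p).symm
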